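/- Let $T=[\boldsymbol v_1,\boldsymbol v_2,\boldsymbol v_3]\subset\mathbb R^2$ be a nondegenerate closed triangle and put $\boldsymbol v_4=\frac{\boldsymbol v_1+\boldsymbol v_2}2$, $\boldsymbol v_5=\frac{\boldsymbol v_2+\boldsymbol v_3}2$, $\boldsymbol v_6=\frac{\boldsymbol v_1+\boldsymbol v_3}2$, $\boldsymbol v_7=\frac{\boldsymbol v_4+\boldsymbol v_6}2$, $\boldsymbol v_8=\frac{\boldsymbol v_4+\boldsymbol v_5}2$, $\boldsymbol v_9=\frac{\boldsymbol v_5+\boldsymbol v_6}2$, $\boldsymbol v_{10}=\frac{\boldsymbol v_1+\boldsymbol v_2+\boldsymbol v_3}3$. The complete graph on $\boldsymbol v_1,\dots,\boldsymbol v_6$ divides $T$ into the 12 faces of the Powell–Sabin 12-split $T_{12}$; each point of $T$ is assigned to exactly one face containing it (half-open faces). Let $\mathcal S^3_5(T_{12})$ be the space of $C^3$ functions on $T$ that are polynomials of total degree at most $5$ on each face. For a multiset $\mathbf K$ of vertices of $T_{12}$, write $[\mathbf K]$ for its convex hull and $[\mathbf K)$ for the union of the half-open faces belonging to the faces contained in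 $[\mathbf K]$. The simplex spline $Q[\mathbf K]$ is defined recursively: it is $0$ if $\operatorname{area}[\mathbf K]=0$; it is $\mathbf 1_{[\mathbf K)}\operatorname{area}(T)/\operatorname{area}[\mathbf K]$ if $|\mathbf K|=3$ and $\operatorname{area}[\mathbf K]\ne0$; otherwise $Q[\mathbf K](\boldsymbol x)=\sum_j\beta_jQ[\mathbf K\setminus\boldsymbol v_j](\boldsymbol x)$, where $\boldsymbol x=\sum_j\beta_j\boldsymbol v_j$, $\sum_j\beta_j=1$ and $\beta_j=0$ for $\boldsymbol v_j\notin\mathbf K$ (for the multisets below the value on $T$ does not depend on the choice of the $\beta_j$ or of the assignment of points to faces). Write $ijklmn$ for $Q[\boldsymbol v_1^i\boldsymbol v_2^j\boldsymbol v_3^k\boldsymbol v_4^l\boldsymbol v_5^m\boldsymbol v_6^n]$ and $w\cdot ijklmn\,(abcde)$ for the scaled spline $S=w\,Q$ together with the domain point $\boldsymbol\xi=\frac15(\boldsymbol v_a+\boldsymbol v_b+\boldsymbol v_c+\boldsymbol v_d+\boldsymbol v_e)$. Each of the six families $\mathcal B_\star$ consists of the 39 scaled splines, with their domain points, that arise from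 the representatives below by the six permutations of $\boldsymbol v_1,\boldsymbol v_2,\boldsymbol v_3$ (acting on all ten vertices). All six contain the classes of $\frac14\cdot600101\,(1,1,1,1,1)$, $\frac14\cdot500201\,(1,1,1,1,4)$, $\frac12\cdot410201\,(1,1,1,4,4)$, $141110\,(2,2,2,4,5)$, $\frac12\cdot131210\,(1,2,2,4,5)$, and in addition those of: - $\mathcal B_a$: $\frac12\cdot320201\,(1,1,2,4,4)$, $\frac34\cdot222110\,(1,2,2,3,10)$, $\frac34\cdot221210\,(1,2,2,4,10)$; - $\mathcal B_b$: $\frac12\cdot320201\,(1,1,2,4,4)$, $\frac34\cdot221111\,(1,2,3,4,10)$, $\frac34\cdot221210\,(1,2,2,4,10)$; - $\mathcal B_c$: $\frac12\cdot320201\,(1,1,2,4,4)$, $\frac34\cdot220211\,(1,2,4,4,10)$, $\frac34\cdot121211\,(1,2,4,5,10)$; - $\mathcal B_d$: $\frac34\cdot222110\,(1,2,2,3,10)$, $321200\,(1,1,2,4,4)$, $\frac14\cdot221210\,(1,2,2,3,4)$; - $\mathcal B_e$: $\frac34\cdot221111\,(1,2,3,4,10)$, $321200\,(1,1,2,4,4)$,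 $\frac14\cdot221210\,(1,2,2,3,4)$; - $\mathcal B_f$: $\frac14\cdot220211\,(1,2,3,4,4)$, $321200\,(1,1,2,4,4)$, $\frac12\cdot121211\,(1,2,3,4,8)$. **Theorem.** For each $\star\in\{a,\dots,f\}$ there is a nonsingular rational $39\times39$ matrix $M_\star$ with $\|M_\star\|_\infty=1$ such that, with $K_\star:=\|M_\star^{-1}\|_\infty>0$ (maximum absolute row sum norm), the following holds for every nondegenerate triangle $T$, where $\mathcal B_\star=\{S_1,\dots,S_{39}\}$ has domain points $\boldsymbol\xi_1,\dots,\boldsymbol\xi_{39}$. 1. $M_\star$ is the collocation matrix $\big(S_j(\boldsymbol\xi_i)\big)_{i,j=1}^{39}$. In particular $M_\star$ and $K_\star$ do not depend on $T$. 2. For every $\boldsymbol c\in\mathbb R^{39}$ the spline $f=\sum_j c_jS_j$ lies in $\mathcal S^3_5(T_{12})$ and $$K_\star^{-1}\|\boldsymbol c\|_\infty\le\|f\|_{L_\infty(T)}\le\|\boldsymbol c\|_\infty .$$ 3. For every $\boldsymbol y\in\mathbb R^{39}$ there is exactly one $\boldsymbol c\in\mathbb R^{39}$ such that $f=\sum_jc_jS_j$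 satisfies $f(\boldsymbol\xi_i)=y_i$ for all $i$; moreover every $f=\sum_jc_jS_j$ satisfies $\|f\|_{L_\infty(T)}\le K_\star\max_i|f(\boldsymbol\xi_i)|$. For $\star=c$, $$K_c=\frac{60866923187443943219194678615331}{836197581250152380489105335680}\approx72.7901 .$$ -/

import Mathlib

open MeasureTheory

attribute [local instance] Matrix.linftyOpNormedAddCommGroup

namespace PS12

noncomputable section

/-- The Euclidean plane. -/
abbrev Plane : Type := EuclideanSpace ℝ (Fin 2)

/-- Twice the signed area of the triangle with vertices `a`, `b`, `c`. -/
def orient (a b c : Plane) : ℝ :=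
  (b 0 - a 0) * (c 1 - a 1) - (b 1 - a 1) * (c 0 - a 0)

/-- The `i`-th barycentric coordinate of `x` with respect to the triangle with
vertices `a`, `b`, `c` (Cramer's rule). -/
def bary (a b c x : Plane) : Fin 3 → ℝ :=
  ![orient x b c / orient a b c, orient a x c / orient a b c, orient a b x / orient a b c]

/-- The closed macrotriangle with vertices `v 0`, `v 1`, `v 2`. -/
def triangle (v : Fin 3 → Plane) : Set Plane := convexHull ℝ (Set.range v)

/-! ### The Powell-Sabin 12-split

The vertices `v₁, …, v₁₀` are indexed by `Fin 10`, starting at `0`. -/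

/-- The ten vertices of the 12-split: the corners, the midpoints of the edges, the
midpoints of the edges of the medial triangle, and the centroid. -/
def vertex (v : Fin 3 → Plane) : Fin 10 → Plane :=
  ![v 0, v 1, v 2,
    midpoint ℝ (v 0) (v 1), midpoint ℝ (v 1) (v 2), midpoint ℝ (v 0) (v 2),
    midpoint ℝ (midpoint ℝ (v 0) (v 1)) (midpoint ℝ (v 0) (v 2)),
    midpoint ℝ (midpoint ℝ (v 0) (v 1)) (midpoint ℝ (v 1) (v 2)),
    midpoint ℝ (midpoint ℝ (v 1) (v 2)) (midpoint ℝ (v 0) (v 2)),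
    (1 / 3 : ℝ) • (v 0 + v 1 + v 2)]

/-- The vertices of the twelve faces (six around the corners, six around the centroid). -/
def faceVertices : Fin 12 → Fin 3 → Fin 10 :=
  ![![0, 5, 6], ![0, 3, 6], ![3, 1, 7], ![1, 4, 7], ![4, 2, 8], ![2, 5, 8],
    ![5, 6, 9], ![3, 6, 9], ![3, 7, 9], ![4, 7, 9], ![4, 8, 9], ![5, 8, 9]]

/-- The closed faces of the 12-split. -/
def face (v : Fin 3 → Plane) (k : Fin 12) : Set Plane :=
  convexHull ℝ (Set.range fun i => vertex v (faceVertices k i))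

/-- The conditions on barycentric coordinates `(a, b, c)` that assign every point of the
macrotriangle to exactly one of the twelve faces. -/
def faceCondition (a b c : ℝ) : Fin 12 → Prop :=
  ![1 / 2 < a ∧ b < c,
    1 / 2 < a ∧ c ≤ b,
    1 / 2 ≤ b ∧ c < 1 / 2 ∧ c < a,
    1 / 2 ≤ b ∧ c < 1 / 2 ∧ a ≤ c,
    1 / 2 ≤ c ∧ a ≤ b,
    1 / 2 ≤ c ∧ b < a,
    a ≤ 1 / 2 ∧ b < 1 / 2 ∧ c < 1 / 2 ∧ c < a ∧ b < c,
    a ≤ 1 / 2 ∧ b < 1 / 2 ∧ c < 1 / 2 ∧ b < a ∧ c ≤ b,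
    a ≤ 1 / 2 ∧ b < 1 / 2 ∧ c < 1 / 2 ∧ a ≤ b ∧ c < a,
    a ≤ 1 / 2 ∧ b < 1 / 2 ∧ c < 1 / 2 ∧ a ≤ c ∧ c ≤ b,
    a ≤ 1 / 2 ∧ b < 1 / 2 ∧ c < 1 / 2 ∧ a ≤ b ∧ b < c,
    a ≤ 1 / 2 ∧ b < 1 / 2 ∧ c < 1 / 2 ∧ b < a ∧ a ≤ c]

/-- The half-open faces, which partition the closed macrotriangle. -/
def halfOpenFace (v : Fin 3 → Plane) (k : Fin 12) : Set Plane :=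
  {x | x ∈ triangle v ∧
    faceCondition (bary (v 0) (v 1) (v 2) x 0) (bary (v 0) (v 1) (v 2) x 1)
      (bary (v 0) (v 1) (v 2) x 2) k}

/-! ### Simplex splines

A knot multiset `{v₁^{m₁} ⋯ v₁₀^{m₁₀}}` is given by its multiplicities `K : Fin 10 → ℕ`. -/

/-- The convex hull `[K]` of a knot multiset. -/
def hull (v : Fin 3 → Plane) (K : Fin 10 → ℕ) : Set Plane :=
  convexHull ℝ (vertex v '' {j | K j ≠ 0})

/-- The half-open convex hull `[K)`: the union of the half-open faces that correspond to the
faces contained in `[K]`. -/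
def halfOpenHull (v : Fin 3 → Plane) (K : Fin 10 → ℕ) : Set Plane :=
  {x | ∃ k, face v k ⊆ hull v K ∧ x ∈ halfOpenFace v k}

/-- Lebesgue area. -/
def area (s : Set Plane) : ℝ := (volume s).toReal

/-- The index triples `i < j < k`, in lexicographic order. -/
def triples : List (Fin 10 × Fin 10 × Fin 10) :=
  (List.finRange 10).flatMap fun i => (List.finRange 10).flatMap fun j =>
    ((List.finRange 10).filter fun k => i < j ∧ j < k).map fun k => (i, j, k)

open Classical in
/-- The first nondegenerate triangle spanned by knots of `K`, if there is one. -/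
def firstTriangle (v : Fin 3 → Plane) (K : Fin 10 → ℕ) : Option (Fin 10 × Fin 10 × Fin 10) :=
  triples.find? fun t => decide (K t.1 ≠ 0 ∧ K t.2.1 ≠ 0 ∧ K t.2.2 ≠ 0 ∧
    orient (vertex v t.1) (vertex v t.2.1) (vertex v t.2.2) ≠ 0)

/-- Coefficients `β_j` with `x = ∑ β_j v_j`, `∑ β_j = 1` and `β_j = 0` whenever `K j = 0`
(see `knotCoord_spec`): the barycentric coordinates of `x` with respect to the first
nondegenerate triangle spanned by knots of `K`. -/
def knotCoord (v : Fin 3 → Plane) (K : Fin 10 → ℕ) (x : Plane) : Fin 10 → ℝ :=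
  match firstTriangle v K with
  | none => 0
  | some (i, j, k) =>
    Pi.single i (bary (vertex v i) (vertex v j) (vertex v k) x 0) +
    Pi.single j (bary (vertex v i) (vertex v j) (vertex v k) x 1) +
    Pi.single k (bary (vertex v i) (vertex v j) (vertex v k) x 2)

theorem knotCoord_spec (v : Fin 3 → Plane) (K : Fin 10 → ℕ) (x : Plane)
    (h : firstTriangle v K ≠ none) :
    ∑ j, knotCoord v K x j = 1 ∧ ∑ j, knotCoord v K x j • vertex v j = x ∧
      ∀ j, K j = 0 → knotCoord v K x j = 0 := by
  obtain ⟨⟨i, j, k⟩, ht⟩ := Option.ne_none_iff_exists'.1 h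
  have hs := List.find?_some ht
  simp only [decide_eq_true_eq] at hs
  obtain ⟨hi, hj, hk, ho⟩ := hs
  have hK : knotCoord v K x = Pi.single i (bary (vertex v i) (vertex v j) (vertex v k) x 0) +
      Pi.single j (bary (vertex v i) (vertex v j) (vertex v k) x 1) +
      Pi.single k (bary (vertex v i) (vertex v j) (vertex v k) x 2) := by
    simp only [knotCoord, ht]
  refine ⟨?_, ?_, ?_⟩
  · simp only [hK, Pi.add_apply, Finset.sum_add_distrib, Finset.sum_pi_single', Finset.mem_univ,
      if_true, bary]
    simp only [Matrix.cons_val]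
    rw [← add_div, ← add_div, div_eq_one_iff_eq ho]
    simp only [orient]; ring
  · simp only [hK, Pi.add_apply, add_smul, Finset.sum_add_distrib, Pi.single_apply, ite_smul,
      zero_smul, Finset.sum_ite_eq', Finset.mem_univ, if_true]
    simp only [bary, Matrix.cons_val]
    ext l
    fin_cases l <;> simp <;> field_simp <;> simp only [orient] <;> ring
  · intro l hl
    have h1 : l ≠ i := by rintro rfl; exact hi hl
    have h2 : l ≠ j := by rintro rfl; exact hj hl
    have h3 : l ≠ k := by rintro rfl; exact hk hl
    simp [hK, h1, h2, h3]

open Classical in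
/-- The area normalized simplex spline of a knot multiset with `|K| = n + 3` knots. -/
def simplexSplineAux (v : Fin 3 → Plane) : ℕ → (Fin 10 → ℕ) → Plane → ℝ
  | 0, K, x =>
    if area (hull v K) = 0 then 0
    else (halfOpenHull v K).indicator (fun _ => area (triangle v) / area (hull v K)) x
  | n + 1, K, x =>
    if area (hull v K) = 0 then 0
    else ∑ j, knotCoord v K x j * simplexSplineAux v n (Function.update K j (K j - 1)) x

/-- The area normalized simplex spline `Q[K]`. (If `|K| < 3`, then `[K]` has area `0` and
`Q[K] = 0`.) -/
def simplexSpline (v : Fin 3 → Plane) (K : Fin 10 → ℕ) : Plane → ℝ :=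
  simplexSplineAux v ((∑ j, K j) - 3) K

/-! ### The six bases -/

/-- The labels of the six bases. -/
inductive BasisLabel
  | a | b | c | d | e | f

/-- The knot multiset `{v₁^i v₂^j v₃^k v₄^l v₅^m v₆^n}`. -/
def knots (i j k l m n : ℕ) : Fin 10 → ℕ := ![i, j, k, l, m, n, 0, 0, 0, 0]

/-- The multiset of dual points with the given labels (from `1` to `10`), as multiplicities;
`dual [1, 1, 1, 1, 4]` belongs to the dual polynomial `c₁⁴ c₄`. -/
def dual (l : List ℕ) : Fin 10 → ℕ := fun j => l.count (j.val + 1)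

/-- One representative of each symmetry class of a basis: its weight, its knots, and its
dual points. -/
def representatives : BasisLabel → List (ℚ × (Fin 10 → ℕ) × (Fin 10 → ℕ))
  | .a => [(1 / 4, knots 6 0 0 1 0 1, dual [1, 1, 1, 1, 1]),
           (1 / 4, knots 5 0 0 2 0 1, dual [1, 1, 1, 1, 4]),
           (1 / 2, knots 4 1 0 2 0 1, dual [1, 1, 1, 4, 4]),
           (1 / 2, knots 3 2 0 2 0 1, dual [1, 1, 2, 4, 4]),
           (1, knots 1 4 1 1 1 0, dual [2, 2, 2, 4, 5]),
           (3 / 4, knots 2 2 2 1 1 0, dual [1, 2, 2, 3, 10]),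
           (1 / 2, knots 1 3 1 2 1 0, dual [1, 2, 2, 4, 5]),
           (3 / 4, knots 2 2 1 2 1 0, dual [1, 2, 2, 4, 10])]
  | .b => [(1 / 4, knots 6 0 0 1 0 1, dual [1, 1, 1, 1, 1]),
           (1 / 4, knots 5 0 0 2 0 1, dual [1, 1, 1, 1, 4]),
           (1 / 2, knots 4 1 0 2 0 1, dual [1, 1, 1, 4, 4]),
           (1 / 2, knots 3 2 0 2 0 1, dual [1, 1, 2, 4, 4]),
           (1, knots 1 4 1 1 1 0, dual [2, 2, 2, 4, 5]),
           (3 / 4, knots 2 2 1 1 1 1, dual [1, 2, 3, 4, 10]),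
           (1 / 2, knots 1 3 1 2 1 0, dual [1, 2, 2, 4, 5]),
           (3 / 4, knots 2 2 1 2 1 0, dual [1, 2, 2, 4, 10])]
  | .c => [(1 / 4, knots 6 0 0 1 0 1, dual [1, 1, 1, 1, 1]),
           (1 / 4, knots 5 0 0 2 0 1, dual [1, 1, 1, 1, 4]),
           (1 / 2, knots 4 1 0 2 0 1, dual [1, 1, 1, 4, 4]),
           (1 / 2, knots 3 2 0 2 0 1, dual [1, 1, 2, 4, 4]),
           (3 / 4, knots 2 2 0 2 1 1, dual [1, 2, 4, 4, 10]),
           (1, knots 1 4 1 1 1 0, dual [2, 2, 2, 4, 5]),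
           (1 / 2, knots 1 3 1 2 1 0, dual [1, 2, 2, 4, 5]),
           (3 / 4, knots 1 2 1 2 1 1, dual [1, 2, 4, 5, 10])]
  | .d => [(1 / 4, knots 6 0 0 1 0 1, dual [1, 1, 1, 1, 1]),
           (1 / 4, knots 5 0 0 2 0 1, dual [1, 1, 1, 1, 4]),
           (1 / 2, knots 4 1 0 2 0 1, dual [1, 1, 1, 4, 4]),
           (1, knots 1 4 1 1 1 0, dual [2, 2, 2, 4, 5]),
           (3 / 4, knots 2 2 2 1 1 0, dual [1, 2, 2, 3, 10]),
           (1, knots 3 2 1 2 0 0, dual [1, 1, 2, 4, 4]),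
           (1 / 2, knots 1 3 1 2 1 0, dual [1, 2, 2, 4, 5]),
           (1 / 4, knots 2 2 1 2 1 0, dual [1, 2, 2, 3, 4])]
  | .e => [(1 / 4, knots 6 0 0 1 0 1, dual [1, 1, 1, 1, 1]),
           (1 / 4, knots 5 0 0 2 0 1, dual [1, 1, 1, 1, 4]),
           (1 / 2, knots 4 1 0 2 0 1, dual [1, 1, 1, 4, 4]),
           (1, knots 1 4 1 1 1 0, dual [2, 2, 2, 4, 5]),
           (3 / 4, knots 2 2 1 1 1 1, dual [1, 2, 3, 4, 10]),
           (1, knots 3 2 1 2 0 0, dual [1, 1, 2, 4, 4]),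
           (1 / 2, knots 1 3 1 2 1 0, dual [1, 2, 2, 4, 5]),
           (1 / 4, knots 2 2 1 2 1 0, dual [1, 2, 2, 3, 4])]
  | .f => [(1 / 4, knots 6 0 0 1 0 1, dual [1, 1, 1, 1, 1]),
           (1 / 4, knots 5 0 0 2 0 1, dual [1, 1, 1, 1, 4]),
           (1 / 2, knots 4 1 0 2 0 1, dual [1, 1, 1, 4, 4]),
           (1 / 4, knots 2 2 0 2 1 1, dual [1, 2, 3, 4, 4]),
           (1, knots 1 4 1 1 1 0, dual [2, 2, 2, 4, 5]),
           (1, knots 3 2 1 2 0 0, dual [1, 1, 2, 4, 4]),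
           (1 / 2, knots 1 3 1 2 1 0, dual [1, 2, 2, 4, 5]),
           (1 / 2, knots 1 2 1 2 1 1, dual [1, 2, 3, 4, 8])]

/-- The six symmetries of the 12-split, as permutations of its ten vertices. -/
def symmetries : List (Fin 10 → Fin 10) :=
  [![0, 1, 2, 3, 4, 5, 6, 7, 8, 9], ![1, 0, 2, 3, 5, 4, 7, 6, 8, 9],
   ![2, 1, 0, 4, 3, 5, 8, 7, 6, 9], ![0, 2, 1, 5, 4, 3, 6, 8, 7, 9],
   ![1, 2, 0, 4, 5, 3, 7, 8, 6, 9], ![2, 0, 1, 5, 3, 4, 8, 6, 7, 9]]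

/-- The elements of a basis: the union of the symmetry classes of the representatives, where
a symmetry acts simultaneously on the knots and on the dual points. -/
def elements (B : BasisLabel) : List (ℚ × (Fin 10 → ℕ) × (Fin 10 → ℕ)) :=
  (representatives B).flatMap fun r =>
    (symmetries.map fun σ => (r.2.1 ∘ σ, r.2.2 ∘ σ)).dedup.map fun p => (r.1, p)

theorem length_elements (B : BasisLabel) : (elements B).length = 39 := by
  cases B <;> decide

/-- The elements of a basis, numbered. -/
def element (B : BasisLabel) (i : Fin 39) : ℚ × (Fin 10 → ℕ) × (Fin 10 → ℕ) :=
  (elements B).get (i.cast (length_elements B).symm)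

/-- The scaled simplex splines `S_i = w_i Q[K_i]` that form the basis. -/
def basisSpline (B : BasisLabel) (v : Fin 3 → Plane) (i : Fin 39) (x : Plane) : ℝ :=
  (element B i).1 * simplexSpline v (element B i).2.1 x

/-- The domain points `ξ_i`: the averages of the five dual points. -/
def domainPoint (B : BasisLabel) (v : Fin 3 → Plane) (i : Fin 39) : Plane :=
  (1 / 5 : ℝ) • ∑ j, ((element B i).2.2 j : ℝ) • vertex v j

/-- The spline `Sᵀ c = ∑ c_i S_i`. -/
def spline (B : BasisLabel) (v : Fin 3 → Plane) (c : Fin 39 → ℝ) (x : Plane) : ℝ :=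
  ∑ i, c i * basisSpline B v i x

/-- The collocation matrix `(S_j(ξ_i))_{i,j}`. -/
def collocation (B : BasisLabel) (v : Fin 3 → Plane) : Matrix (Fin 39) (Fin 39) ℝ :=
  Matrix.of fun i j => basisSpline B v j (domainPoint B v i)

/-- The functions whose restriction to the closed macrotriangle is of class `C^r` and which
agree on each face of the 12-split with a polynomial of total degree at most `d`. -/
def splineSpace (r d : ℕ) (v : Fin 3 → Plane) : Set (Plane → ℝ) :=
  {f | ContDiffOn ℝ r f (triangle v) ∧
    ∀ k, ∃ p : MvPolynomial (Fin 2) ℝ, p.totalDegree ≤ d ∧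
      ∀ x ∈ face v k, f x = MvPolynomial.eval (fun i => x i) p}

end

end PS12

/-!
In barycentric coordinates the triangle disappears from the problem. The vertices of the 12-split
are the integer vectors `ray j` up to positive factors, and the recursion for a simplex spline,
followed on one face of the split, is the recursion `val` for an integer ternary form of degree
`5`; `simplexSplineAux_eq_val` identifies the two. What remains are statements about finitely many
integer forms, which are verified by evaluation.

An identity between integer forms of degree `5` with small coefficients follows from equality at
the single point `kronecker`, where distinct monomials take distinct powers of a large number as
values (`IsSmallForm.eq`). Three facts are obtained in this way.

* Smoothness. The six lines of the split are complete lines, and the polynomials on all faces arise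
  from one of them by adding, for every line `ℓ` on whose positive side the face lies, a jump
  `ℓ ^ 4 * q` (`val_eq_add_jumpSum`). Hence the spline is a polynomial plus truncated powers
  `max ℓ 0 ^ 4 * q` on the whole triangle, and therefore of class `C³` (`contDiff_truncated`).
* Nonnegativity. On each face, the spline has nonnegative coefficients with respect to the
  monomials in coordinates of the cone over the face (`val_eq_ndotR`).
* Partition of unity. On each face, the weighted polynomials of a basis sum to
  `(y₁ + y₂ + y₃) ^ 5` (`sum_val`).

The last two facts give the upper bound `‖f‖ ≤ ‖c‖` and show that all rows of the collocation
matrix sum to `1`, so that its norm is `1`. The domain points have rational barycentric coordinates,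
so the collocation matrix has rational entries that do not depend on the triangle
(`collocation_eq`). Its inverse is computed by fraction-free elimination; only the product of the
two matrices is verified, for rows packed into single integers (`mul_of_checkInverse`). With
`f(ξ) = M c` this gives unique interpolation and `‖c‖ ≤ ‖M⁻¹‖ max |f(ξᵢ)|`
(`norm_coefficients_le`). The maximum is at most the essential supremum of `f`, because `f` is
continuous on the triangle, which is the closure of its interior (`abs_le_eLpNorm`).
-/

namespace PS12

/-! ### Orientation and barycentric coordinates -/

theorem orient_ne_zero {v : Fin 3 → Plane} (hv : AffineIndependent ℝ v) :
    orient (v 0) (v 1) (v 2) ≠ 0 := by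
  intro h
  rw [affineIndependent_iff] at hv
  have key : ∀ α β : ℝ, α • (v 1 - v 0) + β • (v 2 - v 0) = 0 → α = 0 ∧ β = 0 := by
    intro α β hαβ
    have := hv Finset.univ ![-α - β, α, β] (by simp [Fin.sum_univ_three]; ring) (by
      simp only [Fin.sum_univ_three, Matrix.cons_val]
      rw [← hαβ]; module)
    exact ⟨by simpa using this 1 (Finset.mem_univ _), by simpa using this 2 (Finset.mem_univ _)⟩
  simp only [orient] at h
  have h1 := key (v 2 0 - v 0 0) (-(v 1 0 - v 0 0)) (by
    ext l; fin_cases l <;> simp <;> linarith)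
  have h2 := key (v 2 1 - v 0 1) (-(v 1 1 - v 0 1)) (by
    ext l; fin_cases l <;> simp <;> linarith)
  have h3 := key 1 0 (by
    ext l; fin_cases l <;> simp <;> linarith [h1.1, h1.2, h2.1, h2.2])
  exact one_ne_zero h3.1

theorem orient_comb_left (p q r s : Plane) {α β : ℝ} (h : α + β = 1) :
    orient (α • p + β • q) r s = α * orient p r s + β * orient q r s := by
  simp only [orient, PiLp.add_apply, PiLp.smul_apply, smul_eq_mul]
  obtain rfl : β = 1 - α := by linarith
  ring

theorem orient_rotate (p q r : Plane) : orient p q r = orient q r p := by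
  simp only [orient]; ring

theorem orient_swap (p q r : Plane) : orient p q r = - orient q p r := by
  simp only [orient]; ring

theorem bary_comb (a b c x y : Plane) {α β : ℝ} (h : α + β = 1) (i : Fin 3) :
    bary a b c (α • x + β • y) i = α * bary a b c x i + β * bary a b c y i := by
  fin_cases i <;> simp only [bary, Fin.zero_eta, Fin.mk_one, Fin.reduceFinMk, Matrix.cons_val]
  · rw [orient_comb_left _ _ _ _ h]; ring
  · rw [orient_rotate a (α • x + β • y), orient_rotate a x, orient_rotate a y,
      orient_comb_left _ _ _ _ h]; ring
  · rw [← orient_rotate, ← orient_rotate x, ← orient_rotate y, orient_comb_left _ _ _ _ h]; ring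

theorem bary_sum {a b c : Plane} (h : orient a b c ≠ 0) (x : Plane) :
    bary a b c x 0 + bary a b c x 1 + bary a b c x 2 = 1 := by
  simp only [bary, Matrix.cons_val]
  rw [← add_div, ← add_div, div_eq_one_iff_eq h]
  simp only [orient]; ring

theorem bary_combination {a b c : Plane} (h : orient a b c ≠ 0) (x : Plane) :
    bary a b c x 0 • a + bary a b c x 1 • b + bary a b c x 2 • c = x := by
  simp only [bary, Matrix.cons_val]
  ext l
  fin_cases l <;> simp <;> field_simp <;> simp only [orient] <;> ring

/-- A point belongs to a nondegenerate closed triangle if and only if its barycentric coordinates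
are nonnegative. -/
theorem mem_convexHull_iff {p : Fin 3 → Plane} (h : orient (p 0) (p 1) (p 2) ≠ 0) (x : Plane) :
    x ∈ convexHull ℝ (Set.range p) ↔ ∀ i, 0 ≤ bary (p 0) (p 1) (p 2) x i := by
  constructor
  · intro hx
    have hconv : Convex ℝ {x | ∀ i, 0 ≤ bary (p 0) (p 1) (p 2) x i} := by
      intro x hx y hy α β hα hβ hαβ i
      rw [bary_comb _ _ _ _ _ hαβ]
      exact add_nonneg (mul_nonneg hα (hx i)) (mul_nonneg hβ (hy i))
    refine convexHull_min ?_ hconv hx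
    rintro _ ⟨j, rfl⟩ i
    have e : bary (p 0) (p 1) (p 2) (p j) i = if i = j then 1 else 0 := by
      fin_cases j <;> fin_cases i <;> simp [bary, div_self h] <;> left <;> simp only [orient] <;>
        ring
    rw [e]; split_ifs <;> norm_num
  · intro hx
    have := (convex_convexHull ℝ (Set.range p)).sum_mem (t := Finset.univ)
      (w := bary (p 0) (p 1) (p 2) x) (z := p) (fun i _ => hx i)
      (by rw [Fin.sum_univ_three]; exact bary_sum h x)
      (fun i _ => subset_convexHull ℝ _ ⟨i, rfl⟩)
    rwa [Fin.sum_univ_three, bary_combination h] at this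

/-! ### Areas of triangles -/

/-- The area of the standard triangle. -/
noncomputable def unitArea : ℝ :=
  area (convexHull ℝ (Set.range ![(0 : Plane), !₂[1, 0], !₂[0, 1]]))

/-- The area of a triangle, possibly degenerate, is proportional to its orientation. -/
theorem area_convexHull (p : Fin 3 → Plane) :
    area (convexHull ℝ (Set.range p)) = |orient (p 0) (p 1) (p 2)| * unitArea := by
  let M : Matrix (Fin 2) (Fin 2) ℝ :=
    !![p 1 0 - p 0 0, p 2 0 - p 0 0; p 1 1 - p 0 1, p 2 1 - p 0 1]
  let A : Plane →ₗ[ℝ] Plane := Matrix.toEuclideanLin M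
  have hdet : LinearMap.det A = orient (p 0) (p 1) (p 2) := by
    have : LinearMap.det A = M.det := by
      rw [← LinearMap.det_toLin (PiLp.basisFun 2 ℝ (Fin 2)) M]
      rfl
    rw [this, Matrix.det_fin_two]
    simp [M, orient]; ring
  have himg : convexHull ℝ (Set.range p) =
      (fun x => p 0 + x) '' (A '' convexHull ℝ (Set.range ![(0 : Plane), !₂[1, 0], !₂[0, 1]])) := by
    rw [A.image_convexHull, ← Set.range_comp]
    have h2 : (fun x => p 0 + x) =
        (AffineMap.const ℝ Plane (p 0) + AffineMap.id ℝ Plane : Plane →ᵃ[ℝ] Plane) := by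
      ext x; simp
    rw [h2, AffineMap.image_convexHull, ← Set.range_comp]
    congr 2
    ext j l
    fin_cases j <;> fin_cases l <;> simp [A, M, Matrix.toEuclideanLin]
  rw [unitArea, area, himg, Set.image_add_left, measure_preimage_add,
    Measure.addHaar_image_linearMap, hdet, ENNReal.toReal_mul, ENNReal.toReal_ofReal (abs_nonneg _)]
  rfl

theorem unitArea_pos : 0 < unitArea := by
  have h : orient (![(0 : Plane), !₂[1, 0], !₂[0, 1]] 0) (![(0 : Plane), !₂[1, 0], !₂[0, 1]] 1)
      (![(0 : Plane), !₂[1, 0], !₂[0, 1]] 2) ≠ 0 := by simp [orient]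
  have hfin : volume (convexHull ℝ (Set.range ![(0 : Plane), !₂[1, 0], !₂[0, 1]])) ≠ ⊤ :=
    (isBounded_convexHull.2 (Set.finite_range _).isBounded).measure_lt_top.ne
  refine ENNReal.toReal_pos (fun h0 => ?_) hfin
  have hopen : IsOpen {x : Plane | 0 < x 0 ∧ 0 < x 1 ∧ x 0 + x 1 < 1} := by
    have h0 : Continuous fun x : Plane => x 0 := by fun_prop
    have h1 : Continuous fun x : Plane => x 1 := by fun_prop
    exact (isOpen_lt continuous_const h0).inter ((isOpen_lt continuous_const h1).inter
      (isOpen_lt (h0.add h1) continuous_const))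
  have hne : {x : Plane | 0 < x 0 ∧ 0 < x 1 ∧ x 0 + x 1 < 1}.Nonempty :=
    ⟨!₂[1/4, 1/4], by norm_num⟩
  refine (hopen.measure_pos volume hne).ne' (measure_mono_null ?_ h0)
  rintro x ⟨hx0, hx1, hx2⟩
  rw [mem_convexHull_iff h]
  intro i
  fin_cases i <;> simp [bary, orient] <;> linarith

/-! ### The recursion for simplex splines over a ring -/

/-- The value at `y` of the linear form with integer coefficients `l`. -/
def dot {R : Type*} [Add R] [Mul R] [IntCast R] (l : ℤ × ℤ × ℤ) (y : R × R × R) : R :=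
  (l.1 : R) * y.1 + ((l.2.1 : R) * y.2.1 + (l.2.2 : R) * y.2.2)

/-- `dot` over `ℤ`, on instances that the kernel evaluates quickly. -/
def idot (p q : ℤ × ℤ × ℤ) : ℤ := @dot ℤ ⟨Int.add⟩ ⟨Int.mul⟩ ⟨id⟩ p q

/-- The cross product of two integer vectors. -/
def cross (p q : ℤ × ℤ × ℤ) : ℤ × ℤ × ℤ :=
  (p.2.1 * q.2.2 - p.2.2 * q.2.1, p.2.2 * q.1 - p.1 * q.2.2, p.1 * q.2.1 - p.2.1 * q.1)

/-- The primitive integer vector on the ray of the barycentric coordinates of a vertex of the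
12-split. -/
def ray : ℕ → ℤ × ℤ × ℤ
  | 0 => (1, 0, 0) | 1 => (0, 1, 0) | 2 => (0, 0, 1) | 3 => (1, 1, 0) | 4 => (0, 1, 1)
  | 5 => (1, 0, 1) | 6 => (2, 1, 1) | 7 => (1, 2, 1) | 8 => (1, 1, 2) | _ => (1, 1, 1)

/-- The sum of the coordinates of `ray j`. -/
def mass (j : ℕ) : ℤ := idot (1, 1, 1) (ray j)

/-- The determinant of three rays. -/
def idet (i j k : ℕ) : ℤ := idot (ray i) (cross (ray j) (ray k))

/-- The barycentric coordinate that belongs to vertex `i` of the triangle with vertices `i`, `j`,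
`k`, as a linear form in the barycentric coordinates of the macrotriangle. The divisions are exact
for the triangles in `triangles`. -/
def baryForm (i j k : ℕ) : ℤ × ℤ × ℤ :=
  let c := cross (ray j) (ray k)
  let d := idet i j k
  (mass i * c.1 / d, mass i * c.2.1 / d, mass i * c.2.2 / d)

/-- The nondegenerate triangles spanned by the corners and the midpoints of the edges, in
lexicographic order. -/
def triangles : List (ℕ × ℕ × ℕ) :=
  [(0, 1, 2), (0, 1, 4), (0, 1, 5), (0, 2, 3), (0, 2, 4), (0, 3, 4), (0, 3, 5), (0, 4, 5),
    (1, 2, 3), (1, 2, 5), (1, 3, 4), (1, 3, 5), (1, 4, 5), (2, 3, 4), (2, 3, 5), (2, 4, 5),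
    (3, 4, 5)]

/-- The vertices of the faces, as natural numbers. -/
def corners : ℕ → ℕ × ℕ × ℕ
  | 0 => (0, 5, 6) | 1 => (0, 3, 6) | 2 => (3, 1, 7) | 3 => (1, 4, 7) | 4 => (4, 2, 8)
  | 5 => (2, 5, 8) | 6 => (5, 6, 9) | 7 => (3, 6, 9) | 8 => (3, 7, 9) | 9 => (4, 7, 9)
  | 10 => (4, 8, 9) | _ => (5, 8, 9)

/-- The conjunction of `f` over the rays of the three vertices of a face. -/
def allRays (k : ℕ) (f : ℤ × ℤ × ℤ → Bool) : Bool :=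
  f (ray (corners k).1) && (f (ray (corners k).2.1) && f (ray (corners k).2.2))

/-- Nonnegativity of an integer, read off its constructor. -/
def nonneg (z : ℤ) : Bool :=
  match z with
  | .ofNat _ => true
  | .negSucc _ => false

/-- Whether the face `k` is contained in the triangle with vertices `i`, `j`, `l`. -/
def covers (k i j l : ℕ) : Bool :=
  allRays k fun g => nonneg (idot (baryForm i j l) g) &&
    (nonneg (idot (baryForm j l i) g) && nonneg (idot (baryForm l i j) g))

/-- The ratio of the area of the macrotriangle to the area of the triangle with vertices `i`, `j`,
`l`. The division is exact for the triangles in `triangles`. -/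
def height (i j l : ℕ) : ℤ := mass i * mass j * mass l / (idet i j l).natAbs

/-- Application of `f` to `n`. Kernel reduction evaluates `n` to a numeral first, so that equal
arguments become syntactically equal and cached values are found again. -/
def force {α : Type*} (n : ℕ) (f : ℕ → α) : α :=
  match n with
  | 0 => f 0
  | m + 1 => f (Nat.succ m)

/-- Application of `f` to a list, with its entries evaluated as in `force`. -/
def forceList {α : Type*} : List ℕ → (List ℕ → α) → α
  | [], f => f []
  | x :: xs, f => force x fun y => forceList xs fun ys => f (y :: ys)

/-- Application of `f` to a list of Boolean values, evaluated first as in `force`. -/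
def forceBools {α : Type*} : List Bool → (List Bool → α) → α
  | [], f => f []
  | true :: xs, f => forceBools xs fun ys => f (true :: ys)
  | false :: xs, f => forceBools xs fun ys => f (false :: ys)

/-- Removal of one copy of the knot `j`. -/
def remove : List ℕ → ℕ → List ℕ
  | [], _ => []
  | x :: xs, 0 => Nat.pred x :: xs
  | x :: xs, j + 1 => x :: remove xs j

/-- The support of a list of multiplicities. -/
def support : List ℕ → List Bool
  | [] => []
  | 0 :: xs => false :: support xs
  | (_ + 1) :: xs => true :: support xs

/-- The first nondegenerate triangle whose vertices are marked in `s`. -/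
def triangleIn (s : List Bool) : Option (ℕ × ℕ × ℕ) :=
  triangles.find? fun t => s.getD t.1 false && (s.getD t.2.1 false && s.getD t.2.2 false)

/-- The first nondegenerate triangle spanned by the knots of `L`. -/
def leading (L : List ℕ) : Option (ℕ × ℕ × ℕ) := forceBools (support L) triangleIn

/-- The polynomial with which the simplex spline with knot multiplicities `L` on the first six
vertices agrees on the face `k`, at the point with barycentric coordinates `y`. It is defined by
the recursion for simplex splines, over an arbitrary ring: over `ℝ` it describes the spline, over
a polynomial ring it is the polynomial itself, and over `ℤ` it can be evaluated. -/
def val {R : Type*} [Zero R] [Add R] [Mul R] [IntCast R] (k : ℕ) (y : R × R × R) :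
    ℕ → List ℕ → R
  | 0, L => match leading L with
    | none => 0
    | some (i, j, l) => if covers k i j l then ((height i j l : ℤ) : R) else 0
  | n + 1, L => match leading L with
    | none => 0
    | some (i, j, l) =>
      dot (baryForm i j l) y * forceList (remove L i) (val k y n) +
      (dot (baryForm j l i) y * forceList (remove L j) (val k y n) +
      dot (baryForm l i j) y * forceList (remove L l) (val k y n))

/-- `val` over `ℤ`, on instances that the kernel evaluates quickly. -/
def ival (k : ℕ) (y : ℤ × ℤ × ℤ) (n : ℕ) (L : List ℕ) : ℤ :=
  @val ℤ ⟨0⟩ ⟨Int.add⟩ ⟨Int.mul⟩ ⟨id⟩ k y n L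

theorem idot_eq_dot (p q : ℤ × ℤ × ℤ) : idot p q = dot p q := rfl

theorem nonneg_iff {z : ℤ} : nonneg z = true ↔ 0 ≤ z := by
  cases z with
  | ofNat n => simp [nonneg]
  | negSucc n => simp [nonneg]

theorem force_eq {α : Type*} (n : ℕ) (f : ℕ → α) : force n f = f n := by cases n <;> rfl

theorem forceList_eq {α : Type*} (L : List ℕ) (f : List ℕ → α) : forceList L f = f L := by
  induction L generalizing f with
  | nil => rfl
  | cons x xs ih => rw [forceList, force_eq, ih]

theorem forceBools_eq {α : Type*} (L : List Bool) (f : List Bool → α) : forceBools L f = f L := by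
  induction L generalizing f with
  | nil => rfl
  | cons x xs ih => cases x <;> rw [forceBools, ih]

theorem leading_eq (L : List ℕ) : leading L = triangleIn (support L) := forceBools_eq _ _

theorem support_getD (L : List ℕ) (i : ℕ) : (support L).getD i false = decide (L.getD i 0 ≠ 0) := by
  induction L generalizing i with
  | nil => simp [support]
  | cons x xs ih => cases x <;> cases i <;> simp [support] <;> simpa using ih _

/-- The multiplicities of all ten vertices, for knots among the first six. -/
def ofList (L : List ℕ) (j : Fin 10) : ℕ := L.getD j 0

theorem length_remove (L : List ℕ) (i : ℕ) : (remove L i).length = L.length := by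
  induction L generalizing i with
  | nil => rfl
  | cons x xs ih => cases i <;> simp [remove, ih]

theorem getD_remove (L : List ℕ) (i j : ℕ) :
    (remove L i).getD j 0 = if j = i then L.getD j 0 - 1 else L.getD j 0 := by
  induction L generalizing i j with
  | nil => simp [remove]
  | cons x xs ih => cases i <;> cases j <;> (simp [remove]; try simpa using ih _ _)

theorem ofList_remove (L : List ℕ) (j : Fin 10) :
    ofList (remove L j) = Function.update (ofList L) j (ofList L j - 1) := by
  funext i
  simp only [ofList, getD_remove, Function.update_apply, Fin.ext_iff]
  split_ifs with h
  · rw [h]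
  · rfl

theorem sum_remove (L : List ℕ) (i : ℕ) (h : L.getD i 0 ≠ 0) :
    (remove L i).sum + 1 = L.sum := by
  induction L generalizing i with
  | nil => simp at h
  | cons x xs ih =>
    cases i with
    | zero => simp [remove] at h ⊢; omega
    | succ i => simp only [remove, List.sum_cons, ← ih i (by simpa using h)]; omega

theorem sum_ofList {L : List ℕ} (h : L.length = 6) : ∑ j, ofList L j = L.sum := by
  match L, h with
  | [a, b, c, d, e, f], _ => simp [ofList, Fin.sum_univ_succ]

theorem ofList_eq_zero {L : List ℕ} (h : L.length = 6) {j : Fin 10} (hj : 6 ≤ j.val) :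
    ofList L j = 0 := by
  rw [ofList, List.getD_eq_default]; omega

/-! ### Exactness of the integer divisions -/

/-- The division in `height` is exact. -/
theorem triangles_exact : ∀ t ∈ triangles, idet t.1 t.2.1 t.2.2 ≠ 0 ∧
    height t.1 t.2.1 t.2.2 * |idet t.1 t.2.1 t.2.2| = mass t.1 * mass t.2.1 * mass t.2.2 := by
  decide +kernel

/-- The divisions in `baryForm` are exact. -/
theorem baryForm_exact : ∀ t ∈ triangles,
    ∀ s ∈ [t, (t.2.1, t.2.2, t.1), (t.2.2, t.1, t.2.1)],
    idet s.1 s.2.1 s.2.2 = idet t.1 t.2.1 t.2.2 ∧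
    idet s.1 s.2.1 s.2.2 * (baryForm s.1 s.2.1 s.2.2).1 =
      mass s.1 * (cross (ray s.2.1) (ray s.2.2)).1 ∧
    idet s.1 s.2.1 s.2.2 * (baryForm s.1 s.2.1 s.2.2).2.1 =
      mass s.1 * (cross (ray s.2.1) (ray s.2.2)).2.1 ∧
    idet s.1 s.2.1 s.2.2 * (baryForm s.1 s.2.1 s.2.2).2.2 =
      mass s.1 * (cross (ray s.2.1) (ray s.2.2)).2.2 := by
  decide +kernel

theorem mass_pos : ∀ j : Fin 10, 0 < mass j := by decide +kernel

theorem triangles_eq :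
    (triples.filter fun t => decide (t.2.2.val < 6) && !decide (idet t.1 t.2.1 t.2.2 = 0)).map
      (fun t => (t.1.val, t.2.1.val, t.2.2.val)) = triangles := by
  decide +kernel

/-! ### The split in barycentric coordinates -/

noncomputable section

/-- The barycentric coordinates of a point with respect to the macrotriangle. -/
def coords (v : Fin 3 → Plane) (x : Plane) : ℝ × ℝ × ℝ :=
  (bary (v 0) (v 1) (v 2) x 0, bary (v 0) (v 1) (v 2) x 1, bary (v 0) (v 1) (v 2) x 2)

/-- The point with barycentric coordinates `y`. -/
def point (v : Fin 3 → Plane) (y : ℝ × ℝ × ℝ) : Plane := y.1 • v 0 + y.2.1 • v 1 + y.2.2 • v 2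

theorem point_coords {v : Fin 3 → Plane} (hv : orient (v 0) (v 1) (v 2) ≠ 0) (x : Plane) :
    point v (coords v x) = x := bary_combination hv x

theorem coords_sum {v : Fin 3 → Plane} (hv : orient (v 0) (v 1) (v 2) ≠ 0) (x : Plane) :
    (coords v x).1 + (coords v x).2.1 + (coords v x).2.2 = 1 := bary_sum hv x

/-- The barycentric coordinates of a vertex. -/
def vertexCoords (j : ℕ) : ℝ × ℝ × ℝ :=
  ((ray j).1 / mass j, (ray j).2.1 / mass j, (ray j).2.2 / mass j)

theorem vertex_eq_point (v : Fin 3 → Plane) (j : Fin 10) :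
    vertex v j = point v (vertexCoords j) := by
  fin_cases j <;> ext l <;>
    simp [vertex, point, vertexCoords, ray, mass, idot, dot, midpoint_eq_smul_add] <;> ring

theorem vertexCoords_sum (j : Fin 10) :
    (vertexCoords j).1 + (vertexCoords j).2.1 + (vertexCoords j).2.2 = 1 := by
  have h : (mass j : ℝ) ≠ 0 := by exact_mod_cast (mass_pos j).ne'
  simp only [vertexCoords]
  field_simp
  have : (ray j).1 + (ray j).2.1 + (ray j).2.2 = mass j := by simp [mass, idot_eq_dot, dot]; ring
  exact_mod_cast this

theorem orient_point (v : Fin 3 → Plane) {p q r : ℝ × ℝ × ℝ} (hp : p.1 + p.2.1 + p.2.2 = 1)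
    (hq : q.1 + q.2.1 + q.2.2 = 1) (hr : r.1 + r.2.1 + r.2.2 = 1) :
    orient (point v p) (point v q) (point v r) =
      (p.1 * (q.2.1 * r.2.2 - q.2.2 * r.2.1) + (p.2.1 * (q.2.2 * r.1 - q.1 * r.2.2) +
        p.2.2 * (q.1 * r.2.1 - q.2.1 * r.1))) * orient (v 0) (v 1) (v 2) := by
  obtain ⟨p1, p2, p3⟩ := p
  obtain ⟨q1, q2, q3⟩ := q
  obtain ⟨r1, r2, r3⟩ := r
  simp only at hp hq hr
  obtain rfl : p1 = 1 - p2 - p3 := by linarith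
  obtain rfl : q1 = 1 - q2 - q3 := by linarith
  obtain rfl : r1 = 1 - r2 - r3 := by linarith
  simp only [orient, point, PiLp.add_apply, PiLp.smul_apply, smul_eq_mul]
  ring

/-- Vertices are rays divided by their masses, so that orientations of triples of vertices are
determinants of rays up to positive factors. -/
theorem orient_vertex (v : Fin 3 → Plane) (i j k : Fin 10) :
    orient (vertex v i) (vertex v j) (vertex v k) * (mass i * mass j * mass k) =
      idet i j k * orient (v 0) (v 1) (v 2) := by
  have hi : (mass i : ℝ) ≠ 0 := by exact_mod_cast (mass_pos i).ne'
  have hj : (mass j : ℝ) ≠ 0 := by exact_mod_cast (mass_pos j).ne'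
  have hk : (mass k : ℝ) ≠ 0 := by exact_mod_cast (mass_pos k).ne'
  rw [vertex_eq_point, vertex_eq_point, vertex_eq_point,
    orient_point v (vertexCoords_sum i) (vertexCoords_sum j) (vertexCoords_sum k)]
  simp only [vertexCoords, idet, idot_eq_dot, dot, cross]
  push_cast
  field_simp

theorem orient_vertex_left {v : Fin 3 → Plane} (hv : orient (v 0) (v 1) (v 2) ≠ 0) (x : Plane)
    (j k : Fin 10) :
    orient x (vertex v j) (vertex v k) * (mass j * mass k) =
      dot (cross (ray j) (ray k)) (coords v x) * orient (v 0) (v 1) (v 2) := by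
  have hj : (mass j : ℝ) ≠ 0 := by exact_mod_cast (mass_pos j).ne'
  have hk : (mass k : ℝ) ≠ 0 := by exact_mod_cast (mass_pos k).ne'
  rw [vertex_eq_point, vertex_eq_point]
  nth_rw 1 [← point_coords hv x]
  rw [orient_point v (coords_sum hv x) (vertexCoords_sum j) (vertexCoords_sum k)]
  simp only [vertexCoords, dot, cross]
  push_cast
  field_simp

end

/-! ### Knot multisets and their leading triangles -/

theorem corners_eq (k : Fin 12) : (faceVertices k 0).val = (corners k).1 ∧
    (faceVertices k 1).val = (corners k).2.1 ∧ (faceVertices k 2).val = (corners k).2.2 := by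
  revert k; decide

theorem orient_vertex_eq_zero_iff {v : Fin 3 → Plane} (hv : orient (v 0) (v 1) (v 2) ≠ 0)
    (i j k : Fin 10) :
    orient (vertex v i) (vertex v j) (vertex v k) = 0 ↔ idet i j k = 0 := by
  have hi : (mass i : ℝ) ≠ 0 := by exact_mod_cast (mass_pos i).ne'
  have hj : (mass j : ℝ) ≠ 0 := by exact_mod_cast (mass_pos j).ne'
  have hk : (mass k : ℝ) ≠ 0 := by exact_mod_cast (mass_pos k).ne'
  have h := orient_vertex v i j k
  constructor
  · intro h0
    rw [h0, zero_mul, eq_comm, mul_eq_zero] at h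
    exact_mod_cast h.resolve_right hv
  · intro h0
    rw [h0, Int.cast_zero, zero_mul, mul_eq_zero] at h
    exact h.resolve_right (mul_ne_zero (mul_ne_zero hi hj) hk)

/-- The combinatorial search for the leading triangle finds the one that defines `knotCoord`. -/
theorem leading_eq_firstTriangle {v : Fin 3 → Plane} (hv : orient (v 0) (v 1) (v 2) ≠ 0)
    {L : List ℕ} (hL : L.length = 6) :
    leading L = (firstTriangle v (ofList L)).map fun t => (t.1.val, t.2.1.val, t.2.2.val) := by
  rw [leading_eq, triangleIn, ← triangles_eq, List.find?_map, List.find?_filter, firstTriangle]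
  congr 2
  funext t
  obtain ⟨i, j, k⟩ := t
  rw [Bool.eq_iff_iff]
  simp only [support_getD, Function.comp, Bool.and_eq_true, decide_eq_true_eq, Bool.not_eq_true',
    decide_eq_false_iff_not, ne_eq, orient_vertex_eq_zero_iff hv, ofList]
  constructor
  · rintro ⟨⟨-, h1⟩, h2, h3, h4⟩
    exact ⟨h2, h3, h4, h1⟩
  · rintro ⟨h2, h3, h4, h1⟩
    refine ⟨⟨?_, h1⟩, h2, h3, h4⟩
    by_contra h
    exact h4 (ofList_eq_zero hL (j := k) (by omega))

theorem leading_mem {L : List ℕ} {t : ℕ × ℕ × ℕ} (h : leading L = some t) : t ∈ triangles := by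
  rw [leading_eq] at h
  exact List.mem_of_find?_eq_some h

noncomputable section

/-- The barycentric coordinates with respect to a triangle of the recursion are the integer linear
forms `baryForm` in the barycentric coordinates with respect to the macrotriangle. -/
theorem baryForm_spec {v : Fin 3 → Plane} (hv : orient (v 0) (v 1) (v 2) ≠ 0) {i j k : Fin 10}
    (h : (i.val, j.val, k.val) ∈ triangles) (x : Plane) :
    bary (vertex v i) (vertex v j) (vertex v k) x 0 = dot (baryForm i j k) (coords v x) ∧
    bary (vertex v i) (vertex v j) (vertex v k) x 1 = dot (baryForm j k i) (coords v x) ∧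
    bary (vertex v i) (vertex v j) (vertex v k) x 2 = dot (baryForm k i j) (coords v x) := by
  have hi : (mass i : ℝ) ≠ 0 := by exact_mod_cast (mass_pos i).ne'
  have hj : (mass j : ℝ) ≠ 0 := by exact_mod_cast (mass_pos j).ne'
  have hk : (mass k : ℝ) ≠ 0 := by exact_mod_cast (mass_pos k).ne'
  have hd : idet i j k ≠ 0 := (triangles_exact _ h).1
  have ho : orient (vertex v i) (vertex v j) (vertex v k) ≠ 0 := by
    rwa [Ne, orient_vertex_eq_zero_iff hv]
  have hdR : (idet i j k : ℝ) ≠ 0 := by exact_mod_cast hd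
  have main : ∀ (s1 s2 s3 : Fin 10), idet s1 s2 s3 = idet i j k →
      mass s1 * mass s2 * mass s3 = mass i * mass j * mass k →
      idet s1 s2 s3 * (baryForm s1 s2 s3).1 = mass s1 * (cross (ray s2) (ray s3)).1 →
      idet s1 s2 s3 * (baryForm s1 s2 s3).2.1 = mass s1 * (cross (ray s2) (ray s3)).2.1 →
      idet s1 s2 s3 * (baryForm s1 s2 s3).2.2 = mass s1 * (cross (ray s2) (ray s3)).2.2 →
      orient x (vertex v s2) (vertex v s3) / orient (vertex v i) (vertex v j) (vertex v k) =
        dot (baryForm s1 s2 s3) (coords v x) := by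
    intro s1 s2 s3 e hm e1 e2 e3
    have h1 : (mass s1 : ℝ) ≠ 0 := by exact_mod_cast (mass_pos s1).ne'
    have h2 : (mass s2 : ℝ) ≠ 0 := by exact_mod_cast (mass_pos s2).ne'
    have h3 : (mass s3 : ℝ) ≠ 0 := by exact_mod_cast (mass_pos s3).ne'
    have o1 := orient_vertex_left hv x s2 s3
    have o2 := orient_vertex v i j k
    have f : (idet i j k : ℝ) * dot (baryForm s1 s2 s3) (coords v x) =
        mass s1 * dot (cross (ray s2) (ray s3)) (coords v x) := by
      rw [e] at e1 e2 e3
      have e1' : (idet i j k : ℝ) * (baryForm s1 s2 s3).1 =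
        mass s1 * (cross (ray s2) (ray s3)).1 := by exact_mod_cast e1
      have e2' : (idet i j k : ℝ) * (baryForm s1 s2 s3).2.1 =
        mass s1 * (cross (ray s2) (ray s3)).2.1 := by exact_mod_cast e2
      have e3' : (idet i j k : ℝ) * (baryForm s1 s2 s3).2.2 =
        mass s1 * (cross (ray s2) (ray s3)).2.2 := by exact_mod_cast e3
      simp only [dot]
      linear_combination (coords v x).1 * e1' + (coords v x).2.1 * e2' + (coords v x).2.2 * e3'
    rw [div_eq_iff ho]
    have hm' : (mass s1 * mass s2 * mass s3 : ℝ) = mass i * mass j * mass k := by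
      exact_mod_cast hm
    apply mul_right_cancel₀ (mul_ne_zero (mul_ne_zero h1 h2) h3)
    rw [mul_assoc (dot _ _), hm', o2, ← hm']
    linear_combination (mass s1 : ℝ) * o1 - orient (v 0) (v 1) (v 2) * f
  have E := baryForm_exact _ h
  simp only [List.mem_cons, List.not_mem_nil, or_false, forall_eq_or_imp, forall_eq] at E
  obtain ⟨⟨-, a1, a2, a3⟩, ⟨b0, b1, b2, b3⟩, c0, c1, c2, c3⟩ := E
  refine ⟨main i j k rfl rfl a1 a2 a3, ?_, ?_⟩
  · rw [← main j k i b0 (by ring) b1 b2 b3, bary]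
    simp only [Matrix.cons_val]
    rw [orient_rotate (vertex v i) x]
  · rw [← main k i j c0 (by ring) c1 c2 c3, bary]
    simp only [Matrix.cons_val]
    rw [← orient_rotate]

theorem knotCoord_sum {v : Fin 3 → Plane} {K : Fin 10 → ℕ} {t : Fin 10 × Fin 10 × Fin 10}
    (h : firstTriangle v K = some t) (x : Plane) (f : Fin 10 → ℝ) :
    ∑ j, knotCoord v K x j * f j =
      bary (vertex v t.1) (vertex v t.2.1) (vertex v t.2.2) x 0 * f t.1 +
      (bary (vertex v t.1) (vertex v t.2.1) (vertex v t.2.2) x 1 * f t.2.1 +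
      bary (vertex v t.1) (vertex v t.2.1) (vertex v t.2.2) x 2 * f t.2.2) := by
  have hK : knotCoord v K x =
      Pi.single t.1 (bary (vertex v t.1) (vertex v t.2.1) (vertex v t.2.2) x 0) +
      Pi.single t.2.1 (bary (vertex v t.1) (vertex v t.2.1) (vertex v t.2.2) x 1) +
      Pi.single t.2.2 (bary (vertex v t.1) (vertex v t.2.1) (vertex v t.2.2) x 2) := by
    simp only [knotCoord, h]
  simp only [hK, Pi.add_apply, add_mul, Finset.sum_add_distrib, Pi.single_apply, ite_mul, zero_mul,
    Finset.sum_ite_eq', Finset.mem_univ, if_true, add_assoc]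

theorem firstTriangle_spec {v : Fin 3 → Plane} {K : Fin 10 → ℕ} {t : Fin 10 × Fin 10 × Fin 10}
    (h : firstTriangle v K = some t) : K t.1 ≠ 0 ∧ K t.2.1 ≠ 0 ∧ K t.2.2 ≠ 0 ∧
      orient (vertex v t.1) (vertex v t.2.1) (vertex v t.2.2) ≠ 0 := by
  simpa using List.find?_some h

theorem mem_triples {i j k : Fin 10} (h1 : i < j) (h2 : j < k) : (i, j, k) ∈ triples := by
  simp [triples, h1, h2]

theorem firstTriangle_none {v : Fin 3 → Plane} {K : Fin 10 → ℕ} (h : firstTriangle v K = none)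
    {a b c : Fin 10} (ha : K a ≠ 0) (hb : K b ≠ 0) (hc : K c ≠ 0) :
    orient (vertex v a) (vertex v b) (vertex v c) = 0 := by
  have key : ∀ i j k : Fin 10, i < j → j < k → K i ≠ 0 → K j ≠ 0 → K k ≠ 0 →
      orient (vertex v i) (vertex v j) (vertex v k) = 0 := by
    intro i j k h1 h2 hi hj hk
    have := List.find?_eq_none.1 h _ (mem_triples h1 h2)
    simpa [hi, hj, hk] using this
  have refl1 : ∀ p q : Plane, orient p p q = 0 := fun p q => by simp only [orient]; ring
  rcases lt_trichotomy a b with h1 | rfl | h1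
  · rcases lt_trichotomy b c with h2 | rfl | h2
    · exact key _ _ _ h1 h2 ha hb hc
    · rw [orient_rotate, refl1]
    · rcases lt_trichotomy a c with h3 | rfl | h3
      · rw [orient_rotate, orient_swap, ← orient_rotate, key _ _ _ h3 h2 ha hc hb, neg_zero]
      · rw [orient_rotate, orient_rotate, refl1]
      · rw [orient_rotate, orient_rotate, key _ _ _ h3 h1 hc ha hb]
  · exact refl1 _ _
  · rcases lt_trichotomy a c with h2 | rfl | h2
    · rw [orient_swap, key _ _ _ h1 h2 hb ha hc, neg_zero]
    · rw [orient_rotate, orient_rotate, refl1]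
    · rcases lt_trichotomy b c with h3 | rfl | h3
      · rw [orient_rotate, key _ _ _ h3 h2 hb hc ha]
      · rw [orient_rotate, refl1]
      · rw [orient_swap, orient_rotate, orient_rotate, key _ _ _ h3 h1 hc hb ha, neg_zero]

theorem exists_single {K : Fin 10 → ℕ} {n : ℕ} (h : ∑ j, K j = n + 1) :
    ∃ (a : Fin 10) (K' : Fin 10 → ℕ), K = K' + Pi.single a 1 ∧ ∑ j, K' j = n := by
  obtain ⟨a, -, ha⟩ : ∃ a ∈ Finset.univ, K a ≠ 0 := by
    by_contra! hc
    rw [Finset.sum_eq_zero hc] at h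
    omega
  have e : K = (K - Pi.single a 1) + Pi.single a 1 := by
    funext j
    by_cases hj : j = a
    · subst hj; simp; omega
    · simp [hj]
  refine ⟨a, K - Pi.single a 1, e, ?_⟩
  rw [e] at h
  simp only [Pi.add_apply, Finset.sum_add_distrib, Finset.sum_pi_single', Finset.mem_univ,
    if_true] at h
  simpa using h

theorem exists_support {K : Fin 10 → ℕ} (h : ∑ j, K j = 3) :
    ∃ a b c : Fin 10, {j | K j ≠ 0} = {a, b, c} := by
  obtain ⟨a, K1, rfl, h1⟩ := exists_single h
  obtain ⟨b, K2, rfl, h2⟩ := exists_single h1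
  obtain ⟨c, K3, rfl, h3⟩ := exists_single h2
  have h0 : K3 = 0 := by
    funext j
    exact Finset.sum_eq_zero_iff.1 h3 j (Finset.mem_univ _)
  refine ⟨a, b, c, ?_⟩
  ext j
  subst h0
  simp only [Pi.add_apply, Pi.single_apply, Set.mem_ofPred_eq, Set.mem_insert_iff,
    Set.mem_singleton_iff, Pi.zero_apply]
  split_ifs <;> simp_all

theorem area_hull_of_support {v : Fin 3 → Plane} {K : Fin 10 → ℕ} {a b c : Fin 10}
    (h : {j | K j ≠ 0} = {a, b, c}) :
    hull v K = convexHull ℝ (Set.range ![vertex v a, vertex v b, vertex v c]) ∧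
    area (hull v K) = |orient (vertex v a) (vertex v b) (vertex v c)| * unitArea := by
  have e : hull v K = convexHull ℝ (Set.range ![vertex v a, vertex v b, vertex v c]) := by
    rw [hull, h, Set.image_insert_eq, Set.image_insert_eq, Set.image_singleton]
    congr 1
    simp only [Matrix.range_cons, Matrix.range_empty, Set.union_empty]
    rfl
  refine ⟨e, ?_⟩
  rw [e, area_convexHull]
  rfl

theorem area_hull_ne_zero {v : Fin 3 → Plane} {K : Fin 10 → ℕ} {t : Fin 10 × Fin 10 × Fin 10}
    (h : firstTriangle v K = some t) : area (hull v K) ≠ 0 := by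
  obtain ⟨h1, h2, h3, h4⟩ := firstTriangle_spec h
  have hsub : convexHull ℝ (Set.range ![vertex v t.1, vertex v t.2.1, vertex v t.2.2]) ⊆
      hull v K := by
    refine convexHull_mono ?_
    rintro _ ⟨i, rfl⟩
    fin_cases i
    exacts [⟨_, h1, rfl⟩, ⟨_, h2, rfl⟩, ⟨_, h3, rfl⟩]
  have hfin : volume (hull v K) ≠ ⊤ :=
    (isBounded_convexHull.2 (Set.toFinite _).isBounded).measure_lt_top.ne
  have hpos : 0 < area (convexHull ℝ
      (Set.range ![vertex v t.1, vertex v t.2.1, vertex v t.2.2])) := by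
    rw [area_convexHull]
    exact mul_pos (abs_pos.2 h4) unitArea_pos
  exact (hpos.trans_le (ENNReal.toReal_mono hfin (measure_mono hsub))).ne'

theorem support_eq {v : Fin 3 → Plane} {K : Fin 10 → ℕ} {t : Fin 10 × Fin 10 × Fin 10}
    (hK : ∑ j, K j = 3) (h : firstTriangle v K = some t) : {j | K j ≠ 0} = {t.1, t.2.1, t.2.2} := by
  obtain ⟨h1, h2, h3, h4⟩ := firstTriangle_spec h
  obtain ⟨a, b, c, e⟩ := exists_support hK
  have refl1 : ∀ p q : Plane, orient p p q = 0 := fun p q => by simp only [orient]; ring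
  have n12 : t.1 ≠ t.2.1 := fun h' => h4 (by rw [h', refl1])
  have n23 : t.2.1 ≠ t.2.2 := fun h' => h4 (by rw [h', orient_rotate, refl1])
  have n13 : t.1 ≠ t.2.2 := fun h' => h4 (by rw [h', orient_rotate, orient_rotate, refl1])
  have hsub : ({t.1, t.2.1, t.2.2} : Finset (Fin 10)) ⊆ {a, b, c} := by
    intro j hj
    have : j ∈ {j | K j ≠ 0} := by
      simp only [Finset.mem_insert, Finset.mem_singleton] at hj
      rcases hj with rfl | rfl | rfl <;> assumption
    rw [e] at this
    simpa using this
  have hcard : ({a, b, c} : Finset (Fin 10)).card ≤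
      ({t.1, t.2.1, t.2.2} : Finset (Fin 10)).card := by
    rw [Finset.card_eq_three.2 ⟨_, _, _, n12, n13, n23, rfl⟩]
    exact Finset.card_le_three
  have := Finset.eq_of_subset_of_card_le hsub hcard
  rw [e]
  have := congrArg (fun s : Finset (Fin 10) => (s : Set (Fin 10))) this
  simpa using this.symm

end

noncomputable section

/-! ### Simplex splines on half-open faces -/

theorem faceCondition_unique {a b c : ℝ} (h : a + b + c = 1) (hb : 0 ≤ b) (hc : 0 ≤ c)
    {k k' : Fin 12}
    (hk : faceCondition a b c k) (hk' : faceCondition a b c k') : k = k' := by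
  by_contra hne
  fin_cases k <;> fin_cases k' <;> first
    | exact hne rfl
    | (simp only [faceCondition, Fin.zero_eta, Fin.mk_one, Fin.reduceFinMk,
        Matrix.cons_val] at hk hk'
       linarith)

theorem exists_faceCondition (a b c : ℝ) : ∃ k, faceCondition a b c k := by
  by_cases h1 : 1 / 2 < a
  · rcases lt_or_ge b c with h2 | h2
    exacts [⟨0, h1, h2⟩, ⟨1, h1, h2⟩]
  rw [not_lt] at h1
  by_cases h2 : 1 / 2 ≤ c
  · rcases lt_or_ge b a with h3 | h3
    exacts [⟨5, h2, h3⟩, ⟨4, h2, h3⟩]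
  rw [not_le] at h2
  by_cases h3 : 1 / 2 ≤ b
  · rcases lt_or_ge c a with h4 | h4
    exacts [⟨2, h3, h2, h4⟩, ⟨3, h3, h2, h4⟩]
  rw [not_le] at h3
  rcases lt_or_ge b a with h4 | h4
  · rcases lt_or_ge b c with h5 | h5
    · rcases lt_or_ge c a with h6 | h6
      exacts [⟨6, h1, h3, h2, h6, h5⟩, ⟨11, h1, h3, h2, h4, h6⟩]
    · exact ⟨7, h1, h3, h2, h4, h5⟩
  · rcases lt_or_ge c a with h6 | h6
    · exact ⟨8, h1, h3, h2, h4, h6⟩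
    · rcases lt_or_ge b c with h5 | h5
      exacts [⟨10, h1, h3, h2, h4, h5⟩, ⟨9, h1, h3, h2, h6, h5⟩]

theorem exists_halfOpenFace {v : Fin 3 → Plane} {x : Plane} (hx : x ∈ triangle v) :
    ∃ k, x ∈ halfOpenFace v k := by
  obtain ⟨k, hk⟩ := exists_faceCondition (bary (v 0) (v 1) (v 2) x 0) (bary (v 0) (v 1) (v 2) x 1)
    (bary (v 0) (v 1) (v 2) x 2)
  exact ⟨k, hx, hk⟩

theorem mem_halfOpenHull_iff {v : Fin 3 → Plane} (hv : orient (v 0) (v 1) (v 2) ≠ 0) {x : Plane}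
    {k : Fin 12} (hx : x ∈ halfOpenFace v k) (K : Fin 10 → ℕ) :
    x ∈ halfOpenHull v K ↔ face v k ⊆ hull v K := by
  constructor
  · rintro ⟨k', h1, h2⟩
    have h := (mem_convexHull_iff hv x).1 hx.1
    rwa [faceCondition_unique (bary_sum hv x) (h 1) (h 2) hx.2 h2.2]
  · exact fun h => ⟨k, h, hx⟩

theorem coords_point {v : Fin 3 → Plane} (hv : orient (v 0) (v 1) (v 2) ≠ 0) {y : ℝ × ℝ × ℝ}
    (hy : y.1 + y.2.1 + y.2.2 = 1) : coords v (point v y) = y := by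
  have h1 : (1 : ℝ) + 0 + 0 = 1 := by norm_num
  have h2 : (0 : ℝ) + 1 + 0 = 1 := by norm_num
  have h3 : (0 : ℝ) + 0 + 1 = 1 := by norm_num
  have e0 : point v (1, 0, 0) = v 0 := by simp [point]
  have e1 : point v (0, 1, 0) = v 1 := by simp [point]
  have e2 : point v (0, 0, 1) = v 2 := by simp [point]
  have o0 := orient_point v hy (q := (0, 1, 0)) (r := (0, 0, 1)) h2 h3
  have o1 := orient_point v (p := (1, 0, 0)) (r := (0, 0, 1)) h1 hy h3
  have o2 := orient_point v (p := (1, 0, 0)) (q := (0, 1, 0)) h1 h2 hy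
  rw [e1, e2] at o0
  rw [e0, e2] at o1
  rw [e0, e1] at o2
  rw [coords]
  simp only [bary, Matrix.cons_val]
  rw [o0, o1, o2, mul_div_cancel_right₀ _ hv, mul_div_cancel_right₀ _ hv,
    mul_div_cancel_right₀ _ hv]
  ext <;> simp

theorem coords_vertex {v : Fin 3 → Plane} (hv : orient (v 0) (v 1) (v 2) ≠ 0) (j : Fin 10) :
    coords v (vertex v j) = vertexCoords j := by
  rw [vertex_eq_point, coords_point hv (vertexCoords_sum j)]

theorem dot_vertexCoords_nonneg {l : ℤ × ℤ × ℤ} (j : Fin 10) :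
    0 ≤ dot l (vertexCoords j) ↔ 0 ≤ idot l (ray j) := by
  have h : (0 : ℝ) < mass j := by exact_mod_cast mass_pos j
  have e : dot l (vertexCoords j) = (idot l (ray j) : ℝ) / mass j := by
    simp only [dot, vertexCoords, idot_eq_dot, Int.cast_add, Int.cast_mul, Int.cast_id]
    field_simp
  rw [e, le_div_iff₀ h, zero_mul]
  exact_mod_cast Iff.rfl

theorem allRays_iff (k : Fin 12) (f : ℤ × ℤ × ℤ → Bool) :
    allRays k f = true ↔ ∀ i, f (ray (faceVertices k i)) = true := by
  obtain ⟨h0, h1, h2⟩ := corners_eq k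
  simp [allRays, Fin.forall_fin_succ, h0, h1, h2]

theorem covers_iff {v : Fin 3 → Plane} (hv : orient (v 0) (v 1) (v 2) ≠ 0) (k : Fin 12)
    {i j l : Fin 10} (h : (i.val, j.val, l.val) ∈ triangles) :
    covers k i j l = true ↔
      face v k ⊆ convexHull ℝ (Set.range ![vertex v i, vertex v j, vertex v l]) := by
  have ho : orient (vertex v i) (vertex v j) (vertex v l) ≠ 0 := by
    rw [Ne, orient_vertex_eq_zero_iff hv]
    exact (triangles_exact _ h).1
  have hmem : ∀ x, x ∈ convexHull ℝ (Set.range ![vertex v i, vertex v j, vertex v l]) ↔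
      0 ≤ dot (baryForm i j l) (coords v x) ∧ 0 ≤ dot (baryForm j l i) (coords v x) ∧
        0 ≤ dot (baryForm l i j) (coords v x) := by
    intro x
    have := mem_convexHull_iff (p := ![vertex v i, vertex v j, vertex v l]) ho x
    simp only [Matrix.cons_val, Fin.forall_fin_succ, Fin.succ_zero_eq_one, Fin.succ_one_eq_two,
      IsEmpty.forall_iff, and_true] at this
    obtain ⟨b0, b1, b2⟩ := baryForm_spec hv h x
    rw [this, b0, b1, b2]
  rw [covers, allRays_iff, face]
  simp only [Bool.and_eq_true, nonneg_iff]
  rw [(convex_convexHull ℝ _).convexHull_subset_iff, Set.range_subset_iff]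
  refine forall_congr' fun m => ?_
  rw [hmem, coords_vertex hv, dot_vertexCoords_nonneg, dot_vertexCoords_nonneg,
    dot_vertexCoords_nonneg]

/-- On a half-open face, the simplex spline is given by the recursively defined polynomial `val`
in the barycentric coordinates. -/
theorem simplexSplineAux_eq_val {v : Fin 3 → Plane} (hv : orient (v 0) (v 1) (v 2) ≠ 0)
    {k : Fin 12} {x : Plane} (hx : x ∈ halfOpenFace v k) (n : ℕ) {L : List ℕ} (hL : L.length = 6)
    (hsum : L.sum = n + 3) :
    simplexSplineAux v n (ofList L) x = val k (coords v x) n L := by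
  induction n generalizing L with
  | zero =>
    have hK : ∑ j, ofList L j = 3 := by rw [sum_ofList hL, hsum]
    have hlead := leading_eq_firstTriangle hv hL
    rw [simplexSplineAux, val]
    cases ht : firstTriangle v (ofList L) with
    | none =>
      rw [ht] at hlead
      obtain ⟨a, b, c, e⟩ := exists_support hK
      have hne : ∀ j, j ∈ ({a, b, c} : Set (Fin 10)) → ofList L j ≠ 0 := fun j hj => by
        rw [← e] at hj; exact hj
      have : area (hull v (ofList L)) = 0 := by
        rw [(area_hull_of_support e).2, firstTriangle_none ht (hne a (by simp)) (hne b (by simp))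
          (hne c (by simp))]
        simp
      rw [if_pos this, hlead]
      rfl
    | some t =>
      obtain ⟨i, j, l⟩ := t
      rw [ht] at hlead
      simp only [Option.map_some] at hlead
      have hmem := leading_mem hlead
      obtain ⟨e1, e2⟩ := area_hull_of_support (v := v) (support_eq hK ht)
      rw [if_neg (area_hull_ne_zero ht), hlead]
      simp only
      have hcov := covers_iff hv k hmem
      rw [← e1] at hcov
      by_cases hf : face v k ⊆ hull v (ofList L)
      · rw [Set.indicator_of_mem ((mem_halfOpenHull_iff hv hx _).2 hf), if_pos (hcov.2 hf), e2,
          triangle, area_convexHull, mul_div_mul_right _ _ unitArea_pos.ne']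
        have h1 := congrArg abs (orient_vertex v i j l)
        have h2 : (height i j l : ℝ) * |(idet i j l : ℝ)| = mass i * mass j * mass l := by
          exact_mod_cast (triangles_exact _ hmem).2
        have hm : (0 : ℝ) < mass i * mass j * mass l := by
          have hi : (0 : ℝ) < mass i := by exact_mod_cast mass_pos i
          have hj : (0 : ℝ) < mass j := by exact_mod_cast mass_pos j
          have hl : (0 : ℝ) < mass l := by exact_mod_cast mass_pos l
          positivity
        rw [abs_mul, abs_of_pos hm, abs_mul] at h1
        rw [div_eq_iff (abs_ne_zero.2 (firstTriangle_spec ht).2.2.2)]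
        apply mul_right_cancel₀ hm.ne'
        rw [mul_assoc (height i j l : ℝ), h1, ← h2]
        ring
      · rw [Set.indicator_of_notMem (fun h => hf ((mem_halfOpenHull_iff hv hx _).1 h)),
          if_neg (fun h => hf (hcov.1 h))]
  | succ n ih =>
    have hlead := leading_eq_firstTriangle hv hL
    rw [simplexSplineAux, val]
    cases ht : firstTriangle v (ofList L) with
    | none =>
      rw [ht] at hlead
      rw [hlead]
      have : knotCoord v (ofList L) x = 0 := by simp only [knotCoord, ht]
      simp [this]
    | some t =>
      obtain ⟨i, j, l⟩ := t
      rw [ht] at hlead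
      simp only [Option.map_some] at hlead
      have hmem := leading_mem hlead
      obtain ⟨h1, h2, h3, -⟩ := firstTriangle_spec ht
      obtain ⟨b0, b1, b2⟩ := baryForm_spec hv hmem x
      rw [if_neg (area_hull_ne_zero ht), hlead, knotCoord_sum ht]
      simp only [forceList_eq]
      have step : ∀ m : Fin 10, ofList L m ≠ 0 →
          simplexSplineAux v n (Function.update (ofList L) m (ofList L m - 1)) x =
            val k (coords v x) n (remove L m) := by
        intro m hm
        rw [← ofList_remove]
        refine ih (by rw [length_remove, hL]) ?_
        have := sum_remove L m hm
        omega
      rw [step i h1, step j h2, step l h3, b0, b1, b2]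

end

/-! ### Kronecker substitution -/

theorem map_dot {R S : Type*} [CommRing R] [CommRing S] (φ : R →+* S) (l : ℤ × ℤ × ℤ)
    (y : R × R × R) : φ (dot l y) = dot l (φ y.1, φ y.2.1, φ y.2.2) := by
  simp [dot]

theorem map_val {R S : Type*} [CommRing R] [CommRing S] (φ : R →+* S) (k : ℕ) (y : R × R × R)
    (n : ℕ) (L : List ℕ) : φ (val k y n L) = val k (φ y.1, φ y.2.1, φ y.2.2) n L := by
  induction n generalizing L with
  | zero =>
    rw [val, val]
    rcases leading L with _ | ⟨i, j, l⟩
    · exact map_zero φ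
    · simp only
      split_ifs
      · exact map_intCast φ _
      · exact map_zero φ
  | succ n ih =>
    rw [val, val]
    rcases leading L with _ | ⟨i, j, l⟩
    · exact map_zero φ
    · simp only [forceList_eq, map_add, map_mul, map_dot, ih]

/-- The base of the Kronecker substitution. It exceeds twice the absolute values of all
coefficients that occur. -/
def base : ℕ := 2 ^ 48

/-- The point at which integer ternary forms of degree `5` are evaluated: distinct monomials have
as values distinct powers of `base`. -/
def kronecker : ℤ × ℤ × ℤ := (1, Int.ofNat base, Int.ofNat (base ^ 6))

/-- A signed expansion in powers of `b` with coefficients smaller than `b` is unique. -/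
theorem eq_zero_of_sum_pow {ι : Type*} {b : ℤ} (S : Finset ι) (e : ι → ℕ)
    (c : ι → ℤ) (he : Set.InjOn e S) (hc : ∀ i ∈ S, |c i| < b)
    (h : ∑ i ∈ S, c i * b ^ e i = 0) : ∀ i ∈ S, c i = 0 := by
  classical
  induction hn : S.card generalizing S with
  | zero => simp [Finset.card_eq_zero.1 hn]
  | succ n ih =>
    obtain ⟨i, hi, hmin⟩ := S.exists_min_image e (Finset.card_pos.1 (by omega))
    have hb : 0 < b := (abs_nonneg _).trans_lt (hc i hi)
    have hlt : ∀ j ∈ S.erase i, e i + 1 ≤ e j := by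
      intro j hj
      rw [Finset.mem_erase] at hj
      exact lt_of_le_of_ne (hmin j hj.2) fun h => hj.1 (he hj.2 hi h.symm)
    rw [← Finset.add_sum_erase _ _ hi] at h
    have hdvd : b ^ (e i + 1) ∣ ∑ j ∈ S.erase i, c j * b ^ e j :=
      Finset.dvd_sum fun j hj => Dvd.dvd.mul_left (pow_dvd_pow b (hlt j hj)) _
    have hci : c i = 0 := by
      have h2 : b ^ e i * b ∣ b ^ e i * c i := by
        rw [← pow_succ, mul_comm (b ^ e i) (c i)]
        exact (Int.dvd_iff_dvd_of_dvd_add (by rw [h]; exact dvd_zero _)).2 hdvd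
      exact Int.eq_zero_of_abs_lt_dvd ((mul_dvd_mul_iff_left (pow_pos hb _).ne').1 h2) (hc i hi)
    rw [hci, zero_mul, zero_add] at h
    intro j hj
    by_cases hji : j = i
    · rw [hji, hci]
    · exact ih (S.erase i) (he.mono (Finset.erase_subset _ _))
        (fun j hj => hc j (Finset.mem_of_mem_erase hj)) h
        (by rw [Finset.card_erase_of_mem hi]; omega) j (Finset.mem_erase.2 ⟨hji, hj⟩)

noncomputable section

open MvPolynomial

/-- The three variables. -/
def vars : MvPolynomial (Fin 3) ℤ × MvPolynomial (Fin 3) ℤ × MvPolynomial (Fin 3) ℤ :=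
  (X 0, X 1, X 2)

/-- The integer ternary forms of degree `n` with coefficients of absolute value at most `C`. -/
def IsSmallForm (n : ℕ) (C : ℤ) (P : MvPolynomial (Fin 3) ℤ) : Prop :=
  P.IsHomogeneous n ∧ ∀ m, |coeff m P| ≤ C

theorem IsSmallForm.add {n : ℕ} {C D : ℤ} {P Q : MvPolynomial (Fin 3) ℤ}
    (hP : IsSmallForm n C P) (hQ : IsSmallForm n D Q) : IsSmallForm n (C + D) (P + Q) :=
  ⟨hP.1.add hQ.1, fun m => by
    rw [coeff_add]; exact (abs_add_le _ _).trans (add_le_add (hP.2 m) (hQ.2 m))⟩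

theorem IsSmallForm.sub {n : ℕ} {C D : ℤ} {P Q : MvPolynomial (Fin 3) ℤ}
    (hP : IsSmallForm n C P) (hQ : IsSmallForm n D Q) : IsSmallForm n (C + D) (P - Q) :=
  ⟨hP.1.sub hQ.1, fun m => by
    rw [coeff_sub]; exact (abs_sub _ _).trans (add_le_add (hP.2 m) (hQ.2 m))⟩

theorem IsSmallForm.mono {n : ℕ} {C D : ℤ} {P : MvPolynomial (Fin 3) ℤ}
    (hP : IsSmallForm n C P) (h : C ≤ D) : IsSmallForm n D P :=
  ⟨hP.1, fun m => (hP.2 m).trans h⟩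

theorem isSmallForm_zero (n : ℕ) {C : ℤ} (hC : 0 ≤ C) : IsSmallForm n C 0 :=
  ⟨isHomogeneous_zero _ _ _, fun m => by simpa using hC⟩

theorem isSmallForm_intCast {z C : ℤ} (h : |z| ≤ C) : IsSmallForm 0 C z := by
  refine ⟨by
    rw [← map_intCast (MvPolynomial.C : ℤ →+* MvPolynomial (Fin 3) ℤ)]
    exact isHomogeneous_C _ _, fun m => ?_⟩
  rw [← map_intCast (MvPolynomial.C : ℤ →+* MvPolynomial (Fin 3) ℤ), coeff_C]
  split_ifs
  · simpa using h
  · simpa using (abs_nonneg z).trans h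

theorem IsSmallForm.X_mul {n : ℕ} {C : ℤ} {P : MvPolynomial (Fin 3) ℤ}
    (hP : IsSmallForm n C P) (i : Fin 3) : IsSmallForm (n + 1) C (X i * P) := by
  refine ⟨by rw [add_comm]; exact (isHomogeneous_X _ i).mul hP.1, fun m => ?_⟩
  rw [coeff_X_mul']
  split_ifs
  · exact hP.2 _
  · simpa using (abs_nonneg _).trans (hP.2 m)

theorem IsSmallForm.X_pow_mul {n : ℕ} {C : ℤ} {P : MvPolynomial (Fin 3) ℤ}
    (hP : IsSmallForm n C P) (i : Fin 3) (a : ℕ) : IsSmallForm (n + a) C (X i ^ a * P) := by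
  induction a with
  | zero => simpa using hP
  | succ a ih => rw [pow_succ', mul_assoc, ← add_assoc]; exact ih.X_mul i

theorem IsSmallForm.intCast_mul {n : ℕ} {C : ℤ} {P : MvPolynomial (Fin 3) ℤ}
    (hP : IsSmallForm n C P) (z : ℤ) : IsSmallForm n (|z| * C) (z * P) := by
  rw [← map_intCast (MvPolynomial.C : ℤ →+* MvPolynomial (Fin 3) ℤ)]
  refine ⟨hP.1.C_mul _, fun m => ?_⟩
  rw [coeff_C_mul, Int.cast_id, abs_mul]
  exact mul_le_mul_of_nonneg_left (hP.2 m) (abs_nonneg z)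

/-- The sum of the absolute values of the coefficients of a linear form. -/
def size (l : ℤ × ℤ × ℤ) : ℤ := |l.1| + |l.2.1| + |l.2.2|

theorem IsSmallForm.dot_mul {n : ℕ} {C s : ℤ} {P : MvPolynomial (Fin 3) ℤ}
    (hP : IsSmallForm n C P) {l : ℤ × ℤ × ℤ} (hl : size l ≤ s) :
    IsSmallForm (n + 1) (s * C) (dot l vars * P) := by
  have h0 : 0 ≤ C := (abs_nonneg _).trans (hP.2 0)
  have h := ((hP.X_mul 0).intCast_mul l.1).add
    (((hP.X_mul 1).intCast_mul l.2.1).add ((hP.X_mul 2).intCast_mul l.2.2))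
  have e : dot l vars * P = (l.1 : MvPolynomial (Fin 3) ℤ) * (X 0 * P) +
      ((l.2.1 : MvPolynomial (Fin 3) ℤ) * (X 1 * P) +
        (l.2.2 : MvPolynomial (Fin 3) ℤ) * (X 2 * P)) := by
    simp only [dot, vars]; ring
  rw [e]
  refine h.mono ?_
  calc |l.1| * C + (|l.2.1| * C + |l.2.2| * C) = size l * C := by rw [size]; ring
    _ ≤ s * C := mul_le_mul_of_nonneg_right hl h0

theorem IsSmallForm.dot_pow_mul {n : ℕ} {C s : ℤ} {P : MvPolynomial (Fin 3) ℤ}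
    (hP : IsSmallForm n C P) {l : ℤ × ℤ × ℤ} (hl : size l ≤ s) (a : ℕ) :
    IsSmallForm (n + a) (s ^ a * C) (dot l vars ^ a * P) := by
  induction a with
  | zero => simpa using hP
  | succ a ih =>
    rw [pow_succ', mul_assoc, ← add_assoc, pow_succ', mul_assoc]
    exact ih.dot_mul hl

theorem isSmallForm_list_sum {ι : Type*} {n : ℕ} {C : ℤ} (l : List ι)
    (f : ι → MvPolynomial (Fin 3) ℤ) (h : ∀ i ∈ l, IsSmallForm n C (f i)) :
    IsSmallForm n (l.length * C) (l.map f).sum := by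
  induction l with
  | nil => simpa using isSmallForm_zero n le_rfl
  | cons i l ih =>
    rw [List.map_cons, List.sum_cons, List.length_cons]
    have := (h i (by simp)).add (ih fun j hj => h j (by simp [hj]))
    refine this.mono ?_
    push_cast
    linarith

/-- The value at `y` of a form with integer coefficients. -/
def evalAt {R : Type*} [CommRing R] (y : R × R × R) : MvPolynomial (Fin 3) ℤ →+* R :=
  eval₂Hom (Int.castRingHom R) ![y.1, y.2.1, y.2.2]

theorem evalAt_vars {R : Type*} [CommRing R] (y : R × R × R) :
    (evalAt y vars.1, evalAt y vars.2.1, evalAt y vars.2.2) = y := by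
  simp [evalAt, vars]

/-- A quintic form with small coefficients is determined by its value at the Kronecker point. -/
theorem IsSmallForm.eq_zero {C : ℤ} {P : MvPolynomial (Fin 3) ℤ} (hP : IsSmallForm 5 C P)
    (hC : C < base) (h : evalAt kronecker P = 0) : P = 0 := by
  have hdeg : ∀ m ∈ P.support, m 0 + m 1 + m 2 = 5 := by
    intro m hm
    have : m.degree = 5 := by
      rw [Finsupp.degree_eq_weight_one (R := ℕ)]
      exact hP.1 (mem_support_iff.1 hm)
    rwa [Finsupp.degree_eq_sum, Fin.sum_univ_three] at this
  have hsum : ∑ m ∈ P.support, coeff m P * (base : ℤ) ^ (m 1 + 6 * m 2) = 0 := by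
    rw [← h, evalAt, coe_eval₂Hom, eval₂_eq']
    refine Finset.sum_congr rfl fun m _ => ?_
    simp only [Fin.prod_univ_three, kronecker, Matrix.cons_val, one_pow, one_mul, eq_intCast,
      Int.cast_id]
    rw [pow_add, pow_mul]
    norm_cast
  have hinj : Set.InjOn (fun m : Fin 3 →₀ ℕ => m 1 + 6 * m 2) P.support := by
    intro m hm m' hm' hmm
    have h1 := hdeg m hm
    have h2 := hdeg m' hm'
    simp only at hmm
    ext i
    fin_cases i <;> simp only [Fin.zero_eta, Fin.mk_one, Fin.reduceFinMk] <;> omega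
  have := eq_zero_of_sum_pow P.support _ _ hinj (fun m _ => (hP.2 m).trans_lt hC) hsum
  ext m
  by_cases hm : m ∈ P.support
  · rw [this m hm, coeff_zero]
  · rw [notMem_support_iff.1 hm, coeff_zero]

theorem IsSmallForm.eq {C D : ℤ} {P Q : MvPolynomial (Fin 3) ℤ} (hP : IsSmallForm 5 C P)
    (hQ : IsSmallForm 5 D Q) (hCD : C + D < base) (h : evalAt kronecker P = evalAt kronecker Q) :
    P = Q :=
  sub_eq_zero.1 ((hP.sub hQ).eq_zero hCD (by rw [map_sub, h, sub_self]))

end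

/-! ### Coordinates with respect to frames -/

/-- Three integer vectors, used as a basis of the space of barycentric coordinates. -/
abbrev Frame : Type := (ℤ × ℤ × ℤ) × (ℤ × ℤ × ℤ) × (ℤ × ℤ × ℤ)

/-- The combination of the vectors of a frame with coefficients `s`. -/
def combine {R : Type*} [Add R] [Mul R] [IntCast R] (g : Frame) (s : R × R × R) : R × R × R :=
  (dot (g.1.1, g.2.1.1, g.2.2.1) s, dot (g.1.2.1, g.2.1.2.1, g.2.2.2.1) s,
    dot (g.1.2.2, g.2.1.2.2, g.2.2.2.2) s)

/-- The frame of the standard basis. -/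
def unitFrame : Frame := ((1, 0, 0), (0, 1, 0), (0, 0, 1))

/-- The frame of the rays of the vertices of a face. -/
def faceFrame (k : ℕ) : Frame := (ray (corners k).1, ray (corners k).2.1, ray (corners k).2.2)

/-- A linear form in the coordinates of a frame. -/
def pull (g : Frame) (l : ℤ × ℤ × ℤ) : ℤ × ℤ × ℤ := (idot l g.1, idot l g.2.1, idot l g.2.2)

theorem dot_combine {R : Type*} [CommRing R] (g : Frame) (l : ℤ × ℤ × ℤ) (s : R × R × R) :
    dot l (combine g s) = dot (pull g l) s := by
  simp only [dot, combine, pull, idot_eq_dot, Int.cast_add, Int.cast_mul, Int.cast_id]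
  ring

theorem combine_unitFrame {R : Type*} [CommRing R] (s : R × R × R) : combine unitFrame s = s := by
  simp [combine, unitFrame, dot]

/-- In the coordinates of a frame, the barycentric coordinates with respect to all triangles that
occur in the recursion have small coefficients. -/
def IsSmallFrame (g : Frame) : Prop := ∀ t ∈ triangles,
  size (pull g (baryForm t.1 t.2.1 t.2.2)) ≤ 16 ∧ size (pull g (baryForm t.2.1 t.2.2 t.1)) ≤ 16 ∧
    size (pull g (baryForm t.2.2 t.1 t.2.1)) ≤ 16

instance (g : Frame) : Decidable (IsSmallFrame g) :=
  inferInstanceAs (Decidable (∀ t ∈ triangles, _))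

theorem isSmallFrame_unitFrame : IsSmallFrame unitFrame := by decide +kernel

theorem isSmallFrame_faceFrame : ∀ k : Fin 12, IsSmallFrame (faceFrame k) := by decide +kernel

theorem height_le : ∀ t ∈ triangles, |height t.1 t.2.1 t.2.2| ≤ 4 := by decide +kernel

noncomputable section

open MvPolynomial

theorem isSmallForm_val {g : Frame} (hg : IsSmallFrame g) (k n : ℕ) (L : List ℕ) :
    IsSmallForm n (48 ^ n * 4) (val k (combine g vars) n L) := by
  induction n generalizing L with
  | zero =>
    rw [val]
    cases h : leading L with
    | none => exact isSmallForm_zero _ (by norm_num)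
    | some t =>
      obtain ⟨i, j, l⟩ := t
      simp only
      split_ifs
      · exact isSmallForm_intCast (by simpa using height_le _ (leading_mem h))
      · exact isSmallForm_zero _ (by norm_num)
  | succ n ih =>
    rw [val]
    cases h : leading L with
    | none => exact isSmallForm_zero _ (by positivity)
    | some t =>
      obtain ⟨i, j, l⟩ := t
      simp only [forceList_eq, dot_combine]
      obtain ⟨h1, h2, h3⟩ := hg _ (leading_mem h)
      refine (((ih _).dot_mul h1).add (((ih _).dot_mul h2).add ((ih _).dot_mul h3))).mono ?_
      rw [pow_succ]
      linarith

theorem evalAt_val {R : Type*} [CommRing R] (g : Frame) (k n : ℕ) (L : List ℕ) (s : R × R × R) :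
    evalAt s (val k (combine g vars) n L) = val k (combine g s) n L := by
  have h := evalAt_vars s
  rw [map_val]
  congr 1
  rw [← h]
  simp only [combine, map_dot, h]

/-! ### Nonnegative coefficients -/

/-- The exponents `(i, j)` of the monomials `s ^ (5 - i - j) * t ^ i * u ^ j`. -/
def exponents : List (ℕ × ℕ) :=
  (List.range 6).flatMap fun j => (List.range (6 - j)).map fun i => (i, j)

theorem exponents_le : ∀ e ∈ exponents, e.1 + e.2 ≤ 5 := by decide

/-- The values of the monomials at the Kronecker point. -/
def weights : List ℕ := exponents.map fun e => base ^ (e.1 + 6 * e.2)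

/-- The scalar product of two lists of natural numbers. -/
def ndot : List ℕ → List ℕ → ℕ
  | 0 :: xs, _ :: ys => ndot xs ys
  | (x + 1) :: xs, y :: ys => Nat.add (Nat.mul (x + 1) y) (ndot xs ys)
  | _, _ => 0

theorem ndot_cons (x y : ℕ) (xs ys : List ℕ) : ndot (x :: xs) (y :: ys) = x * y + ndot xs ys := by
  cases x
  · simp [ndot]
  · rfl

/-- The value of the simplex spline on face `k` at the Kronecker point of the face. -/
def faceValue (k : ℕ) (L : List ℕ) : ℤ :=
  force k fun k => ival k (combine (faceFrame k) kronecker) 5 L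

theorem faceValue_eq (k : ℕ) (L : List ℕ) :
    faceValue k L = val k (combine (faceFrame k) kronecker) 5 L := force_eq _ _

/-- The coefficients of the simplex spline on face `k`, with respect to the monomials in the
coordinates of the frame of the face; up to positive factors, they are its Bernstein
coefficients. -/
def coefficients (k : ℕ) (L : List ℕ) : List ℕ :=
  weights.map fun w => Nat.mod (Nat.div (faceValue k L).toNat w) base

/-- The upper bound imposed on coefficients. -/
def bound : ℕ := 2 ^ 20

/-- The check that `coefficients` recovers the value at the Kronecker point. -/
def checkCoefficients (k : ℕ) (L : List ℕ) : Bool :=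
  (coefficients k L).all (fun d => Nat.blt d bound) &&
    decide (Int.ofNat (ndot (coefficients k L) weights) = faceValue k L)

/-- The values of the monomials at `s`. -/
def monomials {R : Type*} [CommRing R] (s : R × R × R) : List R :=
  exponents.map fun e => s.1 ^ (5 - e.1 - e.2) * (s.2.1 ^ e.1 * s.2.2 ^ e.2)

/-- The linear combination of the elements of a list with natural numbers as coefficients. -/
def ndotR {R : Type*} [CommRing R] (c : List ℕ) (m : List R) : R :=
  (List.zipWith (fun (d : ℕ) x => (d : R) * x) c m).sum

theorem ndot_eq_ndotR (c d : List ℕ) : (ndot c d : ℤ) = ndotR c (d.map fun x : ℕ => (x : ℤ)) := by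
  induction c generalizing d with
  | nil => simp [ndot, ndotR]
  | cons x xs ih =>
    cases d with
    | nil => simp [ndot, ndotR]
    | cons y ys =>
      rw [ndot_cons, Nat.cast_add, ih]
      simp [ndotR]

theorem map_ndotR {R S : Type*} [CommRing R] [CommRing S] (φ : R →+* S) (c : List ℕ) (m : List R) :
    φ (ndotR c m) = ndotR c (m.map φ) := by
  simp only [ndotR, map_list_sum, List.map_zipWith, map_mul, map_natCast, List.zipWith_map_right]

theorem map_monomials {R S : Type*} [CommRing R] [CommRing S] (φ : R →+* S) (s : R × R × R) :
    (monomials s).map φ = monomials (φ s.1, φ s.2.1, φ s.2.2) := by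
  simp [monomials, Function.comp_def]

theorem monomials_kronecker :
    monomials kronecker = weights.map fun x : ℕ => (x : ℤ) := by
  rw [monomials, weights, List.map_map]
  refine List.map_congr_left fun e _ => ?_
  simp only [kronecker, one_pow, one_mul, Function.comp, pow_add, pow_mul]
  norm_cast

theorem isSmallForm_ndotR {c : List ℕ} (hc : ∀ d ∈ c, d < bound) :
    IsSmallForm 5 (21 * bound) (ndotR c (monomials vars)) := by
  have hlen : (monomials vars).length = 21 := by rw [monomials, List.length_map]; rfl
  have hz : List.zipWith
      (fun (d : ℕ) (x : MvPolynomial (Fin 3) ℤ) => (d : MvPolynomial (Fin 3) ℤ) * x)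
      c (monomials vars) =
      (c.zip (monomials vars)).map fun p => (p.1 : MvPolynomial (Fin 3) ℤ) * p.2 := by
    rw [List.zip, List.map_zipWith]
  rw [ndotR, hz]
  have hb : (0 : ℤ) ≤ bound := Int.natCast_nonneg _
  refine (isSmallForm_list_sum (C := bound) _ _ ?_).mono ?_
  · rintro ⟨d, x⟩ hp
    obtain ⟨h1, h2⟩ := List.of_mem_zip hp
    obtain ⟨e, he, rfl⟩ := List.mem_map.1 h2
    have hle := exponents_le e he
    have one : IsSmallForm 0 1 ((1 : ℤ) : MvPolynomial (Fin 3) ℤ) := isSmallForm_intCast (by simp)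
    have := (((one.X_pow_mul 2 e.2).X_pow_mul 1 e.1).X_pow_mul 0 (5 - e.1 - e.2)).intCast_mul d
    rw [Int.cast_one, mul_one, mul_one, Int.cast_natCast,
      show 0 + e.2 + e.1 + (5 - e.1 - e.2) = 5 by omega] at this
    refine this.mono ?_
    rw [Nat.abs_cast]
    exact_mod_cast (hc d h1).le
  · refine mul_le_mul_of_nonneg_right ?_ hb
    rw [List.length_zip, hlen]
    exact_mod_cast min_le_right _ _

/-- On the face `k`, the simplex spline is a combination of monomials in the coordinates of the
frame of the face with nonnegative coefficients. -/
theorem val_eq_ndotR {k : Fin 12} {L : List ℕ} (h : checkCoefficients k L = true)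
    {R : Type*} [CommRing R] (s : R × R × R) :
    val k (combine (faceFrame k) s) 5 L = ndotR (coefficients k L) (monomials s) := by
  rw [checkCoefficients, Bool.and_eq_true, List.all_eq_true, decide_eq_true_eq] at h
  have hP := isSmallForm_val (isSmallFrame_faceFrame k) k 5 L
  have hQ := isSmallForm_ndotR (c := coefficients k L) fun d hd => by simpa using h.1 d hd
  have e := hP.eq hQ (by norm_num [bound, base]) (by
    rw [evalAt_val, map_ndotR, map_monomials, evalAt_vars, monomials_kronecker, ← ndot_eq_ndotR]
    rw [← faceValue_eq]
    exact h.2.symm)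
  rw [← evalAt_val, e, map_ndotR, map_monomials, evalAt_vars]

theorem ndotR_nonneg (c : List ℕ) {m : List ℝ} (hm : ∀ x ∈ m, 0 ≤ x) : 0 ≤ ndotR c m := by
  refine List.sum_nonneg fun x hx => ?_
  rw [List.mem_iff_get] at hx
  obtain ⟨i, rfl⟩ := hx
  simp only [List.get_eq_getElem, List.getElem_zipWith]
  exact mul_nonneg (Nat.cast_nonneg _) (hm _ (List.getElem_mem _))

theorem monomials_nonneg {s : ℝ × ℝ × ℝ} (h1 : 0 ≤ s.1) (h2 : 0 ≤ s.2.1) (h3 : 0 ≤ s.2.2) :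
    ∀ x ∈ monomials s, 0 ≤ x := by
  intro x hx
  obtain ⟨e, -, rfl⟩ := List.mem_map.1 hx
  positivity

theorem val_nonneg {k : Fin 12} {L : List ℕ} (h : checkCoefficients k L = true) {s : ℝ × ℝ × ℝ}
    (h1 : 0 ≤ s.1) (h2 : 0 ≤ s.2.1) (h3 : 0 ≤ s.2.2) :
    0 ≤ val k (combine (faceFrame k) s) 5 L := by
  rw [val_eq_ndotR h]
  exact ndotR_nonneg _ (monomials_nonneg h1 h2 h3)

end

/-! ### Jumps across the lines of the split -/

/-- The six lines of the split, as linear forms, each with two faces that are separated by that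
line only; the form is positive on the first face. -/
def lines : List ((ℤ × ℤ × ℤ) × ℕ × ℕ) :=
  [((1, -1, 0), 11, 10), ((0, 1, -1), 9, 10), ((1, 0, -1), 8, 9), ((1, -1, -1), 0, 6),
    ((-1, 1, -1), 2, 8), ((-1, -1, 1), 4, 10)]

/-- The residue modulo `base` that is at least `-bound`; it recovers the lowest coefficient of a
form from the value at the Kronecker point if the coefficients are smaller than `bound`. -/
def lowDigit (z : ℤ) : ℤ :=
  Int.sub (Int.emod (Int.add z (Int.ofNat bound)) (Int.ofNat base)) (Int.ofNat bound)

/-- The value at the Kronecker point of the polynomial on the face `k`. -/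
def pieceValue (k : ℕ) (L : List ℕ) : ℤ := force k fun k => ival k kronecker 5 L

theorem pieceValue_eq (k : ℕ) (L : List ℕ) : pieceValue k L = val k kronecker 5 L := force_eq _ _

/-- The linear form `q` for which the polynomials on the two faces adjacent to the line `l` differ
by `l ^ 4 * q`, read off at the Kronecker point. -/
def jump (L : List ℕ) (l : (ℤ × ℤ × ℤ) × ℕ × ℕ) : ℤ × ℤ × ℤ :=
  let q := Int.ediv (Int.sub (pieceValue l.2.1 L) (pieceValue l.2.2 L))
    (Int.pow (idot l.1 kronecker) 4)
  let a := lowDigit q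
  let r := Int.ediv (Int.sub q a) (Int.ofNat base)
  let b := lowDigit r
  (a, b, Int.ediv (Int.sub r b) (Int.ofNat (base ^ 5)))

/-- Whether the linear form `l` is nonnegative on the face `k`. -/
def side (k : ℕ) (l : ℤ × ℤ × ℤ) : Bool := allRays k fun g => nonneg (idot l g)

/-- The value at the Kronecker point of the sum of the jumps over `ls` between the faces `10` and
`k`. -/
def jumpValue (k : ℕ) (L : List ℕ) : List ((ℤ × ℤ × ℤ) × ℕ × ℕ) → ℤ
  | [] => 0
  | l :: ls => bif side k l.1 then
      Int.add (Int.mul (Int.pow (idot l.1 kronecker) 4) (idot (jump L l) kronecker))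
        (jumpValue k L ls)
    else jumpValue k L ls

/-- The check that the polynomials on all faces are obtained from the one on face `10` by adding
the jumps across lines. -/
def checkJumps (L : List ℕ) : Bool :=
  lines.all (fun l => Nat.blt (jump L l).1.natAbs bound && (Nat.blt (jump L l).2.1.natAbs bound &&
    Nat.blt (jump L l).2.2.natAbs bound)) &&
  (List.range 12).all fun k => decide (pieceValue k L =
    Int.add (pieceValue 10 L) (jumpValue k L lines))

/-- The sum of the jumps between the faces `10` and `k`. -/
def jumpSum {R : Type*} [CommRing R] (k : ℕ) (L : List ℕ) (y : R × R × R) : R :=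
  (lines.map fun l => if side k l.1 then dot l.1 y ^ 4 * dot (jump L l) y else 0).sum

theorem jumpValue_eq (k : ℕ) (L : List ℕ) : jumpValue k L lines = jumpSum k L kronecker := by
  rw [jumpSum]
  induction lines with
  | nil => rfl
  | cons l ls ih =>
    rw [jumpValue, ih, List.map_cons, List.sum_cons]
    cases side k l.1
    · simp
    · simp only [cond_true, if_true]
      rfl

theorem map_jumpSum {R S : Type*} [CommRing R] [CommRing S] (φ : R →+* S) (k : ℕ) (L : List ℕ)
    (y : R × R × R) : φ (jumpSum k L y) = jumpSum k L (φ y.1, φ y.2.1, φ y.2.2) := by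
  rw [jumpSum, jumpSum, map_list_sum, List.map_map]
  congr 1
  refine List.map_congr_left fun l _ => ?_
  simp only [Function.comp]
  split_ifs
  · rw [map_mul, map_pow, map_dot, map_dot]
  · exact map_zero φ

theorem size_lines : ∀ l ∈ lines, size l.1 ≤ 3 := by decide

theorem isSmallForm_jumpSum {L : List ℕ} (hL : ∀ l ∈ lines, size (jump L l) ≤ 3 * bound) (k : ℕ) :
    IsSmallForm 5 (6 * (3 ^ 4 * (3 * bound))) (jumpSum k L vars) := by
  have hlen : lines.length = 6 := rfl
  rw [jumpSum]
  refine (isSmallForm_list_sum (C := 3 ^ 4 * (3 * bound)) _ _ fun l hl => ?_).mono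
    (by rw [hlen]; rfl)
  split_ifs
  · have one : IsSmallForm 0 1 ((1 : ℤ) : MvPolynomial (Fin 3) ℤ) := isSmallForm_intCast (by simp)
    have h := (one.dot_mul (hL l hl)).dot_pow_mul (size_lines l hl) 4
    simpa using h
  · exact isSmallForm_zero _ (by positivity)

/-- The polynomials on all faces are obtained from the one on face `10` by adding the jumps across
the lines on whose positive side the face lies. (Face `10` is on the negative side of all lines.) -/
theorem val_eq_add_jumpSum {L : List ℕ} (h : checkJumps L = true) (k : Fin 12)
    {R : Type*} [CommRing R] (y : R × R × R) :
    val k y 5 L = val 10 y 5 L + jumpSum k L y := by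
  rw [checkJumps, Bool.and_eq_true, List.all_eq_true, List.all_eq_true] at h
  have hsize : ∀ l ∈ lines, size (jump L l) ≤ 3 * bound := by
    intro l hl
    have := h.1 l hl
    simp only [Bool.and_eq_true, Nat.blt_eq] at this
    simp only [size, Int.abs_eq_natAbs]
    omega
  have hk := h.2 k (List.mem_range.2 k.2)
  rw [decide_eq_true_eq, jumpValue_eq, pieceValue_eq, pieceValue_eq] at hk
  have hP := isSmallForm_val isSmallFrame_unitFrame k 5 L
  have hQ := (isSmallForm_val isSmallFrame_unitFrame 10 5 L).add (isSmallForm_jumpSum hsize k)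
  have e := hP.eq hQ (by norm_num [bound, base]) (by
    rw [map_add, evalAt_val, evalAt_val, combine_unitFrame, map_jumpSum, evalAt_vars]
    exact hk)
  have := congrArg (evalAt y) e
  rwa [map_add, evalAt_val, evalAt_val, combine_unitFrame, map_jumpSum, evalAt_vars] at this

/-! ### Faces as cones -/

/-- The dual frame of the frame of a face. -/
def dualFrame (k : ℕ) : Frame :=
  let g := faceFrame k
  let d := idot g.1 (cross g.2.1 g.2.2)
  let s (c : ℤ × ℤ × ℤ) := (d * c.1, d * c.2.1, d * c.2.2)
  (s (cross g.2.1 g.2.2), s (cross g.2.2 g.1), s (cross g.1 g.2.1))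

/-- The coordinates of `y` with respect to the frame of a face. -/
def localCoords {R : Type*} [Add R] [Mul R] [IntCast R] (k : ℕ) (y : R × R × R) : R × R × R :=
  (dot (dualFrame k).1 y, dot (dualFrame k).2.1 y, dot (dualFrame k).2.2 y)

/-- All frames of faces are unimodular. -/
theorem combine_localCoords {R : Type*} [CommRing R] (k : Fin 12) (y : R × R × R) :
    combine (faceFrame k) (localCoords k y) = y := by
  obtain ⟨a, b, c⟩ := y
  fin_cases k <;>
    simp [combine, localCoords, dualFrame, faceFrame, corners, ray, cross, idot, dot] <;>
    (try constructor) <;> (try constructor) <;> ring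

/-- The cone of the face `k`. -/
def cone (k : ℕ) : Set (ℝ × ℝ × ℝ) :=
  {y | ∃ s : ℝ × ℝ × ℝ, 0 ≤ s.1 ∧ 0 ≤ s.2.1 ∧ 0 ≤ s.2.2 ∧ y = combine (faceFrame k) s}

theorem mem_cone_of_localCoords {k : Fin 12} {y : ℝ × ℝ × ℝ} (h1 : 0 ≤ (localCoords k y).1)
    (h2 : 0 ≤ (localCoords k y).2.1) (h3 : 0 ≤ (localCoords k y).2.2) : y ∈ cone k :=
  ⟨_, h1, h2, h3, (combine_localCoords k y).symm⟩

theorem mem_cone_of_halfOpenFace {v : Fin 3 → Plane} (hv : orient (v 0) (v 1) (v 2) ≠ 0)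
    {k : Fin 12} {x : Plane} (hx : x ∈ halfOpenFace v k) : coords v x ∈ cone k := by
  have hs := bary_sum hv x
  have hpos := (mem_convexHull_iff hv x).1 hx.1
  have h0 := hpos 0
  have h1 := hpos 1
  have h2 := hpos 2
  have hc := hx.2
  fin_cases k <;> simp only [faceCondition, Fin.zero_eta, Fin.mk_one, Fin.reduceFinMk,
    Matrix.cons_val] at hc <;> apply mem_cone_of_localCoords <;>
    simp [coords, localCoords, dualFrame, faceFrame, corners, ray, cross, idot, dot] <;> linarith

theorem coords_comb (v : Fin 3 → Plane) (x y : Plane) {α β : ℝ} (h : α + β = 1) :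
    coords v (α • x + β • y) = α • coords v x + β • coords v y := by
  simp only [coords, bary_comb _ _ _ _ _ h]
  rfl

theorem mem_cone_of_face {v : Fin 3 → Plane} (hv : orient (v 0) (v 1) (v 2) ≠ 0)
    {k : Fin 12} {x : Plane} (hx : x ∈ face v k) : coords v x ∈ cone k := by
  have hconv : Convex ℝ {x | coords v x ∈ cone k} := by
    rintro x ⟨s, s1, s2, s3, hs⟩ y ⟨t, t1, t2, t3, ht⟩ α β hα hβ hαβ
    refine ⟨α • s + β • t, ?_, ?_, ?_, ?_⟩
    · exact add_nonneg (mul_nonneg hα s1) (mul_nonneg hβ t1)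
    · exact add_nonneg (mul_nonneg hα s2) (mul_nonneg hβ t2)
    · exact add_nonneg (mul_nonneg hα s3) (mul_nonneg hβ t3)
    · rw [coords_comb _ _ _ hαβ, hs, ht]
      simp only [combine, dot]
      ext <;> simp <;> ring
  refine convexHull_min ?_ hconv hx
  rintro _ ⟨i, rfl⟩
  show coords v (vertex v (faceVertices k i)) ∈ cone k
  rw [coords_vertex hv]
  have hm : (0 : ℝ) ≤ 1 / mass (faceVertices k i) := by
    have : (0 : ℝ) < mass (faceVertices k i) := by exact_mod_cast mass_pos _
    positivity
  obtain ⟨c0, c1, c2⟩ := corners_eq k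
  fin_cases i
  · refine ⟨(1 / mass (faceVertices k 0), 0, 0), hm, le_rfl, le_rfl, ?_⟩
    simp [combine, faceFrame, dot, vertexCoords, ← c0, div_eq_mul_inv]
  · refine ⟨(0, 1 / mass (faceVertices k 1), 0), le_rfl, hm, le_rfl, ?_⟩
    simp [combine, faceFrame, dot, vertexCoords, ← c1, div_eq_mul_inv]
  · refine ⟨(0, 0, 1 / mass (faceVertices k 2)), le_rfl, le_rfl, hm, ?_⟩
    simp [combine, faceFrame, dot, vertexCoords, ← c2, div_eq_mul_inv]

theorem mem_triangle_of_cone {v : Fin 3 → Plane} (hv : orient (v 0) (v 1) (v 2) ≠ 0)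
    {k : Fin 12} {x : Plane} (hx : coords v x ∈ cone k) : x ∈ triangle v := by
  obtain ⟨s, h1, h2, h3, e⟩ := hx
  have hray : ∀ j, 0 ≤ (ray j).1 ∧ 0 ≤ (ray j).2.1 ∧ 0 ≤ (ray j).2.2 := by
    intro j
    unfold ray
    split <;> decide
  have hray' : ∀ j, (0 : ℝ) ≤ (ray j).1 ∧ (0 : ℝ) ≤ (ray j).2.1 ∧ (0 : ℝ) ≤ (ray j).2.2 := by
    intro j
    exact_mod_cast hray j
  obtain ⟨a1, a2, a3⟩ := hray' (corners k).1
  obtain ⟨b1, b2, b3⟩ := hray' (corners k).2.1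
  obtain ⟨c1, c2, c3⟩ := hray' (corners k).2.2
  rw [triangle, mem_convexHull_iff hv]
  simp only [coords, combine, faceFrame, dot, Prod.mk.injEq] at e
  obtain ⟨e0, e1, e2⟩ := e
  intro i
  fin_cases i
  · simp only [Fin.zero_eta, e0]; positivity
  · simp only [Fin.mk_one, e1]; positivity
  · simp only [Fin.reduceFinMk, e2]; positivity

/-- No line of the split passes through the interior of a face. -/
theorem side_or : ∀ k : Fin 12, ∀ l ∈ lines, side k l.1 = false →
    allRays k (fun g => nonneg (- idot l.1 g)) = true := by
  decide +kernel

theorem dot_nonneg_of_cone {k : ℕ} {y : ℝ × ℝ × ℝ} (hy : y ∈ cone k) {l : ℤ × ℤ × ℤ}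
    (h : side k l = true) : 0 ≤ dot l y := by
  obtain ⟨s, h1, h2, h3, rfl⟩ := hy
  simp only [side, allRays, Bool.and_eq_true, nonneg_iff] at h
  rw [dot_combine]
  obtain ⟨a, b, c⟩ := h
  have a' : (0 : ℝ) ≤ (pull (faceFrame k) l).1 := by exact_mod_cast a
  have b' : (0 : ℝ) ≤ (pull (faceFrame k) l).2.1 := by exact_mod_cast b
  have c' : (0 : ℝ) ≤ (pull (faceFrame k) l).2.2 := by exact_mod_cast c
  simp only [dot]
  positivity

theorem dot_nonpos_of_cone {k : Fin 12} {y : ℝ × ℝ × ℝ} (hy : y ∈ cone k)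
    {l : (ℤ × ℤ × ℤ) × ℕ × ℕ} (hl : l ∈ lines) (h : side k l.1 = false) : dot l.1 y ≤ 0 := by
  have h' := side_or k l hl h
  have e : side k (-l.1.1, -l.1.2.1, -l.1.2.2) = true := by
    rw [← h', side]
    congr 1
    funext g
    congr 1
    simp only [idot_eq_dot, dot, Int.cast_id]
    ring
  have := dot_nonneg_of_cone hy e
  simp only [dot] at this ⊢
  push_cast at this
  linarith

noncomputable section

/-! ### Smoothness -/

theorem contDiff_max_pow (n : ℕ) : ContDiff ℝ n fun t : ℝ => max t 0 ^ (n + 1) := by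
  induction n with
  | zero =>
    rw [Nat.cast_zero, contDiff_zero]
    fun_prop
  | succ n ih =>
    have hd : ∀ t : ℝ, HasDerivAt (fun t : ℝ => max t 0 ^ (n + 1 + 1))
        ((n + 2 : ℝ) * max t 0 ^ (n + 1)) t := by
      intro t
      rcases lt_trichotomy t 0 with h | rfl | h
      · rw [max_eq_right h.le, zero_pow (by omega), mul_zero]
        refine (hasDerivAt_const t (0 : ℝ)).congr_of_eventuallyEq ?_
        filter_upwards [gt_mem_nhds h] with s hs
        rw [max_eq_right hs.le, zero_pow (by omega)]
      · rw [max_self, zero_pow (by omega), mul_zero, hasDerivAt_iff_isLittleO_nhds_zero]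
        simp only [zero_add, max_self, smul_zero, sub_zero, ne_eq, Nat.add_eq_zero_iff, one_ne_zero,
          and_false, not_false_eq_true, zero_pow]
        have : (fun h : ℝ => max h 0 ^ (n + 1 + 1)) =O[nhds 0] fun h : ℝ => h ^ (n + 1 + 1) := by
          refine Asymptotics.IsBigO.of_bound 1 (Filter.Eventually.of_forall fun h => ?_)
          rw [norm_pow, norm_pow, one_mul]
          refine pow_le_pow_left₀ (norm_nonneg _) ?_ _
          rw [Real.norm_eq_abs, Real.norm_eq_abs, abs_of_nonneg (le_max_right h 0)]
          exact max_le (le_abs_self h) (abs_nonneg h)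
        exact this.trans_isLittleO (Asymptotics.isLittleO_pow_id (by omega))
      · rw [max_eq_left h.le]
        have := hasDerivAt_pow (n + 1 + 1) t
        simp only [Nat.add_sub_cancel] at this
        push_cast at this
        rw [show (n : ℝ) + 1 + 1 = n + 2 by ring] at this
        refine this.congr_of_eventuallyEq ?_
        filter_upwards [lt_mem_nhds h] with s hs
        rw [max_eq_left hs.le]
    rw [Nat.cast_succ, contDiff_succ_iff_deriv]
    refine ⟨fun t => (hd t).differentiableAt, by simp, ?_⟩
    rw [funext fun t => (hd t).deriv]
    exact contDiff_const.mul ih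

theorem bary_affine (a b c : Plane) (i : Fin 3) : ∃ α β γ : ℝ, ∀ x : Plane,
    bary a b c x i = α + β * x 0 + γ * x 1 := by
  fin_cases i
  · refine ⟨(b 0 * c 1 - b 1 * c 0) / orient a b c, (b 1 - c 1) / orient a b c,
      (c 0 - b 0) / orient a b c, fun x => ?_⟩
    simp only [Fin.zero_eta, bary, Matrix.cons_val]
    rw [orient]; ring
  · refine ⟨(c 0 * a 1 - c 1 * a 0) / orient a b c, (c 1 - a 1) / orient a b c,
      (a 0 - c 0) / orient a b c, fun x => ?_⟩
    simp only [Fin.mk_one, bary, Matrix.cons_val]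
    rw [orient]; ring
  · refine ⟨(a 0 * b 1 - a 1 * b 0) / orient a b c, (a 1 - b 1) / orient a b c,
      (b 0 - a 0) / orient a b c, fun x => ?_⟩
    simp only [Fin.reduceFinMk, bary, Matrix.cons_val]
    rw [orient]; ring

theorem contDiff_bary {n : WithTop ℕ∞} (a b c : Plane) (i : Fin 3) :
    ContDiff ℝ n fun x => bary a b c x i := by
  obtain ⟨α, β, γ, h⟩ := bary_affine a b c i
  simp only [h]
  fun_prop

theorem contDiff_dot_coords {n : WithTop ℕ∞} (v : Fin 3 → Plane) (l : ℤ × ℤ × ℤ) :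
    ContDiff ℝ n fun x => dot l (coords v x) := by
  simp only [dot, coords]
  exact (contDiff_const.mul (contDiff_bary _ _ _ _)).add
    ((contDiff_const.mul (contDiff_bary _ _ _ _)).add (contDiff_const.mul (contDiff_bary _ _ _ _)))

theorem contDiff_val {m : WithTop ℕ∞} (v : Fin 3 → Plane) (k n : ℕ) (L : List ℕ) :
    ContDiff ℝ m fun x => val k (coords v x) n L := by
  induction n generalizing L with
  | zero =>
    simp only [val]
    exact contDiff_const
  | succ n ih =>
    simp only [val]
    rcases leading L with _ | ⟨i, j, l⟩
    · exact contDiff_const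
    · simp only [forceList_eq]
      exact ((contDiff_dot_coords _ _).mul (ih _)).add (((contDiff_dot_coords _ _).mul (ih _)).add
        ((contDiff_dot_coords _ _).mul (ih _)))

/-- The function that continues the polynomial on the face `10` across the lines of the split by
truncated powers. -/
def truncated (v : Fin 3 → Plane) (L : List ℕ) (x : Plane) : ℝ :=
  val 10 (coords v x) 5 L +
    (lines.map fun l => max (dot l.1 (coords v x)) 0 ^ 4 * dot (jump L l) (coords v x)).sum

theorem contDiff_truncated (v : Fin 3 → Plane) (L : List ℕ) :
    ContDiff ℝ (3 : ℕ) (truncated v L) := by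
  refine (contDiff_val v 10 5 L).add ?_
  have h : ∀ ls : List ((ℤ × ℤ × ℤ) × ℕ × ℕ), ContDiff ℝ (3 : ℕ) fun x : Plane =>
      (ls.map fun l => max (dot l.1 (coords v x)) 0 ^ 4 * dot (jump L l) (coords v x)).sum := by
    intro ls
    induction ls with
    | nil => simpa using contDiff_const
    | cons l ls ih =>
      simp only [List.map_cons, List.sum_cons]
      exact (((contDiff_max_pow 3).comp (contDiff_dot_coords v l.1)).mul
        (contDiff_dot_coords v _)).add ih
  exact h lines

/-- On the positive side of a line, the truncated power is the jump; on the other, it vanishes. -/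
theorem truncated_eq_val {v : Fin 3 → Plane} {L : List ℕ} (h : checkJumps L = true) {k : Fin 12}
    {x : Plane} (hx : coords v x ∈ cone k) : truncated v L x = val k (coords v x) 5 L := by
  rw [val_eq_add_jumpSum h k, truncated, jumpSum]
  congr 2
  refine List.map_congr_left fun l hl => ?_
  cases hs : side k l.1 with
  | false => simp [max_eq_right (dot_nonpos_of_cone hx hl hs)]
  | true => simp [max_eq_left (dot_nonneg_of_cone hx hs)]

theorem simplexSpline_eq_truncated {v : Fin 3 → Plane} (hv : orient (v 0) (v 1) (v 2) ≠ 0)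
    {L : List ℕ} (hL : L.length = 6) (hsum : L.sum = 8) (h : checkJumps L = true) {x : Plane}
    (hx : x ∈ triangle v) : simplexSpline v (ofList L) x = truncated v L x := by
  obtain ⟨k, hk⟩ := exists_halfOpenFace hx
  rw [truncated_eq_val h (mem_cone_of_halfOpenFace hv hk), simplexSpline, sum_ofList hL, hsum]
  exact simplexSplineAux_eq_val hv hk 5 hL hsum

/-- On each closed face, the simplex spline agrees with the polynomial `val`. -/
theorem simplexSpline_eq_val {v : Fin 3 → Plane} (hv : orient (v 0) (v 1) (v 2) ≠ 0)
    {L : List ℕ} (hL : L.length = 6) (hsum : L.sum = 8) (h : checkJumps L = true) {k : Fin 12}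
    {x : Plane} (hx : coords v x ∈ cone k) :
    simplexSpline v (ofList L) x = val k (coords v x) 5 L := by
  rw [simplexSpline_eq_truncated hv hL hsum h (mem_triangle_of_cone hv hx), truncated_eq_val h hx]

theorem simplexSpline_nonneg {v : Fin 3 → Plane} (hv : orient (v 0) (v 1) (v 2) ≠ 0)
    {L : List ℕ} (hL : L.length = 6) (hsum : L.sum = 8) (h : checkJumps L = true)
    (h' : ∀ k : Fin 12, checkCoefficients k L = true) {x : Plane}
    (hx : x ∈ triangle v) : 0 ≤ simplexSpline v (ofList L) x := by
  obtain ⟨k, hk⟩ := exists_halfOpenFace hx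
  have hc := mem_cone_of_halfOpenFace hv hk
  rw [simplexSpline_eq_val hv hL hsum h hc]
  obtain ⟨s, h1, h2, h3, e⟩ := hc
  rw [e]
  exact val_nonneg (h' k) h1 h2 h3

/-! ### Membership in the spline space -/

open MvPolynomial in
theorem totalDegree_val_le {y : MvPolynomial (Fin 2) ℝ × MvPolynomial (Fin 2) ℝ ×
    MvPolynomial (Fin 2) ℝ} (h1 : y.1.totalDegree ≤ 1) (h2 : y.2.1.totalDegree ≤ 1)
    (h3 : y.2.2.totalDegree ≤ 1) (k n : ℕ) (L : List ℕ) : (val k y n L).totalDegree ≤ n := by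
  have hint : ∀ z : ℤ, (z : MvPolynomial (Fin 2) ℝ).totalDegree = 0 := by
    intro z
    rw [← map_intCast (C : ℝ →+* MvPolynomial (Fin 2) ℝ), totalDegree_C]
  have hmul : ∀ (z : ℤ) (p : MvPolynomial (Fin 2) ℝ), p.totalDegree ≤ 1 →
      ((z : MvPolynomial (Fin 2) ℝ) * p).totalDegree ≤ 1 := by
    intro z p hp
    refine (totalDegree_mul _ _).trans ?_
    rw [hint, zero_add]
    exact hp
  have hadd : ∀ (m : ℕ) (p q : MvPolynomial (Fin 2) ℝ), p.totalDegree ≤ m → q.totalDegree ≤ m →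
      (p + q).totalDegree ≤ m := fun m p q hp hq =>
    (totalDegree_add _ _).trans (max_le hp hq)
  have hdot : ∀ l : ℤ × ℤ × ℤ, (dot l y).totalDegree ≤ 1 := fun l =>
    hadd _ _ _ (hmul _ _ h1) (hadd _ _ _ (hmul _ _ h2) (hmul _ _ h3))
  induction n generalizing L with
  | zero =>
    rw [val]
    rcases leading L with _ | ⟨i, j, l⟩
    · simp
    · simp only
      split_ifs
      · rw [hint]
      · simp
  | succ n ih =>
    rw [val]
    rcases leading L with _ | ⟨i, j, l⟩
    · simp
    · simp only [forceList_eq]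
      have hstep : ∀ l L', (dot l y * val k y n L').totalDegree ≤ n + 1 := fun l L' =>
        (totalDegree_mul _ _).trans (by have := hdot l; have := ih L'; omega)
      exact hadd _ _ _ (hstep _ _) (hadd _ _ _ (hstep _ _) (hstep _ _))

open MvPolynomial in
theorem exists_polynomial_val (v : Fin 3 → Plane) (k : ℕ) (L : List ℕ) :
    ∃ p : MvPolynomial (Fin 2) ℝ, p.totalDegree ≤ 5 ∧
      ∀ x : Plane, val k (coords v x) 5 L = MvPolynomial.eval (fun i => x i) p := by
  have h : ∀ i, ∃ p : MvPolynomial (Fin 2) ℝ, p.totalDegree ≤ 1 ∧ ∀ x : Plane,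
      bary (v 0) (v 1) (v 2) x i = MvPolynomial.eval (fun i => x i) p := by
    intro i
    obtain ⟨α, β, γ, h⟩ := bary_affine (v 0) (v 1) (v 2) i
    refine ⟨C α + C β * X 0 + C γ * X 1, ?_, fun x => by simp [h]⟩
    refine (totalDegree_add _ _).trans (max_le ((totalDegree_add _ _).trans (max_le ?_ ?_)) ?_)
    · simp
    · exact (totalDegree_mul _ _).trans (by simp)
    · exact (totalDegree_mul _ _).trans (by simp)
  choose p hp hpx using h
  refine ⟨val k (p 0, p 1, p 2) 5 L, totalDegree_val_le (hp 0) (hp 1) (hp 2) _ _ _, fun x => ?_⟩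
  rw [map_val, coords, hpx, hpx, hpx]

theorem simplexSpline_mem_splineSpace {v : Fin 3 → Plane} (hv : orient (v 0) (v 1) (v 2) ≠ 0)
    {L : List ℕ} (hL : L.length = 6) (hsum : L.sum = 8) (h : checkJumps L = true) :
    simplexSpline v (ofList L) ∈ splineSpace 3 5 v := by
  constructor
  · exact (contDiff_truncated v L).contDiffOn.congr fun x hx =>
      simplexSpline_eq_truncated hv hL hsum h hx
  · intro k
    obtain ⟨p, hp, e⟩ := exists_polynomial_val v k L
    exact ⟨p, hp, fun x hx => by
      rw [← e, simplexSpline_eq_val hv hL hsum h (mem_cone_of_face hv hx)]⟩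

theorem sum_mem_splineSpace {ι : Type*} (s : Finset ι) {r d : ℕ} {v : Fin 3 → Plane} (c : ι → ℝ)
    {f : ι → Plane → ℝ} (hf : ∀ i ∈ s, f i ∈ splineSpace r d v) :
    (fun x => ∑ i ∈ s, c i * f i x) ∈ splineSpace r d v := by
  constructor
  · exact ContDiffOn.sum fun i hi => contDiffOn_const.mul (hf i hi).1
  · intro k
    choose! p hp hpx using fun i hi => (hf i hi).2 k
    refine ⟨∑ i ∈ s, MvPolynomial.C (c i) * p i, ?_, fun x hx => ?_⟩
    · refine MvPolynomial.totalDegree_finsetSum_le fun i hi => ?_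
      refine (MvPolynomial.totalDegree_mul _ _).trans ?_
      rw [MvPolynomial.totalDegree_C, zero_add]
      exact hp i hi
    · rw [map_sum]
      refine Finset.sum_congr rfl fun i hi => ?_
      rw [map_mul, MvPolynomial.eval_C, hpx i hi x hx]

end

/-! ### Evaluation of the splines of a basis -/

/-- The multiplicities of the first six vertices. -/
def toList (K : Fin 10 → ℕ) : List ℕ := [K 0, K 1, K 2, K 3, K 4, K 5]

/-- Sixty times the barycentric coordinates of the domain point with dual points `D`. -/
def site (D : Fin 10 → ℕ) : ℤ × ℤ × ℤ :=
  (((List.finRange 10).map fun j : Fin 10 => 12 / mass j * D j * (ray j).1).sum,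
    ((List.finRange 10).map fun j : Fin 10 => 12 / mass j * D j * (ray j).2.1).sum,
    ((List.finRange 10).map fun j : Fin 10 => 12 / mass j * D j * (ray j).2.2).sum)

/-- An element of a basis in integers: four times its weight, its knots, and sixty times its
domain point. -/
def entry (e : ℚ × (Fin 10 → ℕ) × (Fin 10 → ℕ)) : ℕ × List ℕ × (ℤ × ℤ × ℤ) :=
  ((4 * e.1).num.toNat, toList e.2.1, site e.2.2)

/-- The elements of a basis in integers. -/
def entries (B : BasisLabel) : List (ℕ × List ℕ × (ℤ × ℤ × ℤ)) := (elements B).map entry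

/-- The checks on the individual splines of a basis. -/
def checkSplines (B : BasisLabel) : Bool :=
  (entries B).all fun e => forceList e.2.1 fun L => checkJumps L &&
    (List.range 12).all fun k => force k fun k => checkCoefficients k L

/-- Four times the sum of the splines of a basis on face `k`, at the Kronecker point. -/
def unityValue (k : ℕ) : List (ℕ × List ℕ × (ℤ × ℤ × ℤ)) → ℤ
  | [] => 0
  | e :: es => Int.add (Int.mul (Int.ofNat e.1) (forceList e.2.1 fun L => pieceValue k L))
      (unityValue k es)

/-- The check that the splines of a basis form a partition of unity. -/
def checkUnity (B : BasisLabel) : Bool :=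
  (List.range 12).all fun k => decide (unityValue k (entries B) =
    Int.mul 4 (Int.pow (idot (1, 1, 1) kronecker) 5))

/-- Whether `y` belongs to the cone of the face `k`. -/
def inside (k : ℕ) (y : ℤ × ℤ × ℤ) : Bool :=
  nonneg (idot (dualFrame k).1 y) &&
    (nonneg (idot (dualFrame k).2.1 y) && nonneg (idot (dualFrame k).2.2 y))

/-- A face whose cone contains `y`. -/
def home (y : ℤ × ℤ × ℤ) : ℕ := ((List.range 12).find? fun k => inside k y).getD 0

/-- The values at `y` of the monomials in the coordinates of the frame of the face `k`. -/
def naturalMonomials (k : ℕ) (y : ℤ × ℤ × ℤ) : List ℕ :=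
  exponents.map fun e => Nat.mul (Nat.pow (idot (dualFrame k).1 y).natAbs (5 - e.1 - e.2))
    (Nat.mul (Nat.pow (idot (dualFrame k).2.1 y).natAbs e.1)
      (Nat.pow (idot (dualFrame k).2.2 y).natAbs e.2))

/-- The values of the splines with entries `E` at a point of face `k` where the monomials have the
values `m`, up to a common factor. -/
def row (E : List (ℕ × List ℕ × (ℤ × ℤ × ℤ))) (k : ℕ) (m : List ℕ) : List ℕ :=
  E.map fun e => Nat.mul e.1 (forceList e.2.1 fun L => ndot (coefficients k L) m)

/-- The common denominator of the collocation matrices: the factor `60 ^ 5` comes from the domain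
points and the factor `4` from the weights. -/
def denominator : ℕ := 4 * 60 ^ 5

/-- The rows of `denominator` times the collocation matrix. -/
def rows (B : BasisLabel) : List (List ℕ) :=
  (entries B).map fun e => force (home e.2.2) fun k => row (entries B) k (naturalMonomials k e.2.2)

/-! ### Inversion of integer matrices -/

/-- The base of the encoding of rows of integers as single integers. -/
def radix : ℤ := Int.ofNat (2 ^ 1536)

/-- A shift that makes all digits of an encoded row of length `78` nonnegative. -/
def shift : ℤ := (List.range 78).foldr (fun _ s => Int.add (Int.mul s radix) (2 ^ 1535)) 0

/-- The signed digit number `e` of an encoded row. -/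
def digit (e : ℕ) (z : ℤ) : ℤ :=
  Int.sub (Int.emod (Int.ediv (Int.add z shift) (Int.pow radix e)) radix) (2 ^ 1535)

/-- The integer whose digits in base `radix` are those of `s` followed by the given ones. -/
def encode : List ℕ → ℤ → ℤ
  | [], s => s
  | x :: xs, s => encode xs (Int.add (Int.mul s radix) (Int.ofNat x))

/-- One step of fraction-free elimination: column `i` is cleared by means of the row `p`, whose
pivot is `a`; the previous pivot is `d`. -/
def eliminate (i : ℕ) (d a p : ℤ) : ℕ → List ℤ → List ℤ
  | _, [] => []
  | r, z :: zs => (bif Nat.beq r i then z else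
      Int.ediv (Int.sub (Int.mul a z) (Int.mul (digit (77 - i) z) p)) d) ::
        eliminate i d a p (r + 1) zs

/-- Fraction-free Gauss-Jordan elimination: `n` steps, starting with column `i`. -/
def gaussJordan : ℕ → ℕ → ℤ → List ℤ → ℤ × List ℤ
  | 0, _, d, R => (d, R)
  | n + 1, i, d, R =>
    let p := R.getD i 0
    let a := digit (77 - i) p
    gaussJordan n (i + 1) a (eliminate i d a p 0 R)

/-- The determinant `d` and the adjugate of a matrix of size `39`, by elimination in the matrix with
the identity matrix appended. That the product with the original matrix is `d` is verified by
`checkInverse` for the computed result. -/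
def adjugate (N : List (List ℕ)) : ℤ × List (List ℤ) :=
  let r := gaussJordan 39 0 1 ((N.zip (List.range 39)).map fun r =>
    Int.add (Int.mul (encode r.1 0) (Int.pow radix 39)) (Int.pow radix r.2))
  (r.1, r.2.map fun z => (List.range 39).map fun j => digit j z)

/-- The integer with the given signed digits. -/
def decode : List ℤ → ℤ
  | [] => 0
  | x :: xs => Int.add x (Int.mul radix (decode xs))

/-- The linear combination of the integers `X` with coefficients `c`. -/
def combination : List ℕ → List ℤ → ℤ
  | 0 :: c, _ :: X => combination c X
  | (x + 1) :: c, r :: X => Int.add (Int.mul (Int.ofNat (x + 1)) r) (combination c X)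
  | _, _ => 0

/-- The check that `X` is `d` times a right inverse of `N`, with encoded rows of `X`. -/
def checkInverse (N : List (List ℕ)) (d : ℤ) (X : List (List ℤ)) : Bool :=
  (Nat.beq X.length 39) && (X.all fun r => Nat.beq r.length 39) && !decide (d = 0) &&
  Nat.blt d.natAbs (2 ^ 1500) && (X.all fun r => r.all fun z => Nat.blt z.natAbs (2 ^ 1400)) &&
  (N.all fun r => r.all fun z => Nat.blt z (2 ^ 40)) &&
  (N.zip (List.range 39)).all fun r =>
    decide (combination r.1 (X.map decode) = Int.mul d (Int.pow radix r.2))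

/-- The checks on the collocation matrix. -/
def checkMatrix (B : BasisLabel) : Bool :=
  ((entries B).all fun e => force (home e.2.2) fun k => Nat.blt k 12 && inside k e.2.2) &&
  ((rows B).all fun r => Nat.beq r.sum denominator) &&
  checkInverse (rows B) (adjugate (rows B)).1 (adjugate (rows B)).2

/-- The absolute row sums of a matrix. -/
def rowSums (X : List (List ℤ)) : List ℕ := X.map fun r => (r.map Int.natAbs).sum

/-- The largest absolute row sum of a matrix. -/
def maxRowSum (X : List (List ℤ)) : ℕ := (rowSums X).foldr max 0

/-- All checks for a basis. -/
def check (B : BasisLabel) : Bool := checkSplines B && checkUnity B && checkMatrix B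

/-- The check of the norm of the inverse of the collocation matrix of the basis `c`. -/
def checkNorm : Bool :=
  decide (60866923187443943219194678615331 * (adjugate (rows .c)).1.natAbs =
    836197581250152380489105335680 * (denominator * maxRowSum (adjugate (rows .c)).2))

/-! ### Results of the evaluation -/

/-- All checks succeed. Two bases share a declaration here and below, so that the values of their
common splines are evaluated only once. -/
theorem check_a_b : (check .a && check .b) = true := by decide +kernel

theorem check_d_e : (check .d && check .e) = true := by decide +kernel

theorem check_c_f : (check .c && checkNorm && check .f) = true := by decide +kernel

theorem check_eq_true (B : BasisLabel) : check B = true := by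
  have h₁ := check_a_b
  have h₂ := check_d_e
  have h₃ := check_c_f
  simp only [Bool.and_eq_true] at h₁ h₂ h₃
  cases B
  exacts [h₁.1, h₁.2, h₃.1.1, h₂.1, h₂.2, h₃.2]

theorem checkNorm_eq_true : checkNorm = true := by
  have h := check_c_f
  simp only [Bool.and_eq_true] at h
  exact h.1.2

/-! ### Splines of a basis -/

/-- The data of `entry` describe the elements of the bases faithfully: all knots are among the first
six vertices, there are `8` of them, weights are multiples of `1 / 4` and at most `1`, and
barycentric coordinates sum to `1`. -/
theorem elements_spec (B : BasisLabel) : ∀ e ∈ elements B, ofList (entry e).2.1 = e.2.1 ∧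
    (entry e).2.1.sum = 8 ∧ e.1 = ((entry e).1 : ℚ) / 4 ∧ (entry e).1 ≤ 4 ∧
    (entry e).2.2.1 + (entry e).2.2.2.1 + (entry e).2.2.2.2 = 60 := by
  cases B <;> decide +kernel

theorem element_mem (B : BasisLabel) (i : Fin 39) : element B i ∈ elements B :=
  List.get_mem _ _

theorem length_entries (B : BasisLabel) : (entries B).length = 39 := by
  rw [entries, List.length_map, length_elements]

theorem getElem_entries (B : BasisLabel) (i : Fin 39) (h : i.val < (entries B).length) :
    (entries B)[i.val] = entry (element B i) := by
  simp [entries, element]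

theorem entry_mem (B : BasisLabel) (i : Fin 39) : entry (element B i) ∈ entries B :=
  List.mem_map_of_mem (element_mem B i)

theorem sum_element {R : Type*} [AddCommMonoid R] (B : BasisLabel)
    (f : ℕ × List ℕ × (ℤ × ℤ × ℤ) → R) :
    ∑ i, f (entry (element B i)) = ((entries B).map f).sum := by
  rw [entries, List.map_map, ← Fin.sum_univ_fun_getElem]
  exact Fintype.sum_equiv (finCongr (length_elements B).symm) _ _ fun i => by simp [element]

theorem checkJumps_entry (B : BasisLabel) {e : ℕ × List ℕ × (ℤ × ℤ × ℤ)} (he : e ∈ entries B) :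
    checkJumps e.2.1 = true := by
  have h := check_eq_true B
  simp only [check, Bool.and_eq_true, checkSplines, List.all_eq_true, forceList_eq] at h
  exact (h.1.1 e he).1

theorem checkCoefficients_entry (B : BasisLabel) {e : ℕ × List ℕ × (ℤ × ℤ × ℤ)}
    (he : e ∈ entries B) (k : Fin 12) : checkCoefficients k e.2.1 = true := by
  have h := check_eq_true B
  simp only [check, Bool.and_eq_true, checkSplines, List.all_eq_true, forceList_eq, force_eq] at h
  exact (h.1.1 e he).2 k (List.mem_range.2 k.2)

theorem basisSpline_eq_val (B : BasisLabel) {v : Fin 3 → Plane}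
    (hv : orient (v 0) (v 1) (v 2) ≠ 0) (i : Fin 39) {k : Fin 12} {x : Plane}
    (hx : coords v x ∈ cone k) : basisSpline B v i x =
      (entry (element B i)).1 / 4 * val k (coords v x) 5 (entry (element B i)).2.1 := by
  obtain ⟨h1, h2, h3, -, -⟩ := elements_spec B _ (element_mem B i)
  rw [basisSpline, ← h1, simplexSpline_eq_val hv rfl h2 (checkJumps_entry B (entry_mem B i)) hx]
  congr 1
  rw [h3]
  norm_num

theorem basisSpline_nonneg (B : BasisLabel) {v : Fin 3 → Plane}
    (hv : orient (v 0) (v 1) (v 2) ≠ 0) (i : Fin 39) {x : Plane} (hx : x ∈ triangle v) :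
    0 ≤ basisSpline B v i x := by
  obtain ⟨h1, h2, h3, -, -⟩ := elements_spec B _ (element_mem B i)
  refine mul_nonneg ?_ ?_
  · rw [h3]
    push_cast
    positivity
  · rw [← h1]
    exact simplexSpline_nonneg hv rfl h2 (checkJumps_entry B (entry_mem B i))
      (checkCoefficients_entry B (entry_mem B i)) hx

theorem spline_mem_splineSpace (B : BasisLabel) {v : Fin 3 → Plane}
    (hv : orient (v 0) (v 1) (v 2) ≠ 0) (c : Fin 39 → ℝ) : spline B v c ∈ splineSpace 3 5 v := by
  have e : spline B v c = fun x => ∑ i, (c i * (element B i).1) *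
      simplexSpline v (element B i).2.1 x := by
    funext x
    simp only [spline, basisSpline, mul_assoc]
  rw [e]
  refine sum_mem_splineSpace _ _ fun i _ => ?_
  obtain ⟨h1, h2, -, -, -⟩ := elements_spec B _ (element_mem B i)
  rw [← h1]
  exact simplexSpline_mem_splineSpace hv rfl h2 (checkJumps_entry B (entry_mem B i))

/-! ### Partition of unity -/

theorem unityValue_eq (k : ℕ) (E : List (ℕ × List ℕ × (ℤ × ℤ × ℤ))) :
    unityValue k E = (E.map fun e => (e.1 : ℤ) * val k kronecker 5 e.2.1).sum := by
  induction E with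
  | nil => rfl
  | cons e E ih =>
    rw [List.map_cons, List.sum_cons, ← ih, unityValue, forceList_eq, pieceValue_eq]
    rfl

theorem evalAt_sum_val {R : Type*} [CommRing R] (k : ℕ) (E : List (ℕ × List ℕ × (ℤ × ℤ × ℤ)))
    (y : R × R × R) : evalAt y (E.map fun e => ((e.1 : ℤ) : MvPolynomial (Fin 3) ℤ) *
      val k (combine unitFrame vars) 5 e.2.1).sum =
      (E.map fun e => (e.1 : R) * val k y 5 e.2.1).sum := by
  rw [map_list_sum, List.map_map]
  congr 1
  refine List.map_congr_left fun e _ => ?_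
  rw [Function.comp_apply, map_mul, evalAt_val, combine_unitFrame, map_intCast, Int.cast_natCast]

/-- On every face, the polynomials of the basis sum to `(y₁ + y₂ + y₃) ^ 5`: both sides are forms
with small coefficients that agree at the Kronecker point. -/
theorem sum_val (B : BasisLabel) (k : Fin 12) {R : Type*} [CommRing R] (y : R × R × R) :
    ((entries B).map fun e => (e.1 : R) * val k y 5 e.2.1).sum =
      4 * (y.1 + (y.2.1 + y.2.2)) ^ 5 := by
  have h := check_eq_true B
  simp only [check, Bool.and_eq_true, checkUnity, List.all_eq_true, decide_eq_true_eq] at h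
  have hk := h.1.2 k (List.mem_range.2 k.2)
  rw [unityValue_eq] at hk
  have hP := isSmallForm_list_sum (n := 5) (C := 4 * (48 ^ 5 * 4)) (entries B)
    (fun e => ((e.1 : ℤ) : MvPolynomial (Fin 3) ℤ) * val k (combine unitFrame vars) 5 e.2.1) <| by
      intro e he
      refine ((isSmallForm_val isSmallFrame_unitFrame k 5 e.2.1).intCast_mul e.1).mono ?_
      obtain ⟨e', he', rfl⟩ := List.mem_map.1 he
      have := (elements_spec B e' he').2.2.2.1
      rw [Nat.abs_cast]
      gcongr
      exact_mod_cast this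
  have one : IsSmallForm 0 1 ((1 : ℤ) : MvPolynomial (Fin 3) ℤ) := isSmallForm_intCast (by simp)
  have hQ := (one.dot_pow_mul (l := (1, 1, 1)) (s := 3) (by simp [size]) 5).intCast_mul 4
  rw [length_entries] at hP
  have e := hP.eq hQ (by norm_num [base]) (by
    rw [evalAt_sum_val, map_mul, map_mul, map_pow, map_dot, evalAt_vars, map_intCast, map_intCast,
      Int.cast_one, mul_one]
    exact hk)
  have := congrArg (evalAt y) e
  rw [evalAt_sum_val, map_mul, map_mul, map_pow, map_dot, evalAt_vars, map_intCast, map_intCast,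
    Int.cast_one, mul_one] at this
  simpa [dot] using this

theorem sum_basisSpline (B : BasisLabel) {v : Fin 3 → Plane}
    (hv : orient (v 0) (v 1) (v 2) ≠ 0) {x : Plane} (hx : x ∈ triangle v) :
    ∑ i, basisSpline B v i x = 1 := by
  obtain ⟨k, hk⟩ := exists_halfOpenFace hx
  have hc := mem_cone_of_halfOpenFace hv hk
  have h4 := sum_val B k (coords v x)
  rw [← add_assoc, coords_sum hv, one_pow, ← sum_element] at h4
  have : ∀ i, basisSpline B v i x = 1 / 4 * ((entry (element B i)).1 *
      val k (coords v x) 5 (entry (element B i)).2.1) := fun i => by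
    rw [basisSpline_eq_val B hv i hc]; ring
  simp only [this]
  rw [← Finset.mul_sum, h4]
  norm_num

/-! ### The collocation matrix -/

theorem twelve_div_mass : ∀ j : Fin 10, 12 / mass j * mass j = 12 := by decide

theorem domainPoint_eq_point (B : BasisLabel) (v : Fin 3 → Plane) (i : Fin 39) :
    domainPoint B v i = point v (((entry (element B i)).2.2.1 : ℝ) / 60,
      ((entry (element B i)).2.2.2.1 : ℝ) / 60, ((entry (element B i)).2.2.2.2 : ℝ) / 60) := by
  have h : ∀ j : Fin 10, ∀ z : ℤ, (z / mass j : ℝ) = ((12 / mass j : ℤ) : ℝ) * z / 12 := by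
    intro j z
    have h1 : ((12 / mass j : ℤ) : ℝ) * mass j = 12 := by exact_mod_cast twelve_div_mass j
    have h2 : (mass j : ℝ) ≠ 0 := by exact_mod_cast (mass_pos j).ne'
    field_simp
    linear_combination (-z : ℝ) * h1
  simp only [domainPoint, entry, site, vertex_eq_point, point, vertexCoords, h,
    ← Fin.sum_univ_def]
  ext l
  simp only [PiLp.add_apply, PiLp.smul_apply, smul_eq_mul, WithLp.ofLp_sum, Finset.sum_apply,
    Int.cast_sum, Int.cast_mul, Int.cast_natCast, Finset.mul_sum, Finset.sum_div, Finset.sum_mul,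
    ← Finset.sum_add_distrib]
  exact Finset.sum_congr rfl fun j _ => by ring

theorem coords_domainPoint (B : BasisLabel) {v : Fin 3 → Plane}
    (hv : orient (v 0) (v 1) (v 2) ≠ 0) (i : Fin 39) :
    coords v (domainPoint B v i) = (((entry (element B i)).2.2.1 : ℝ) / 60,
      ((entry (element B i)).2.2.2.1 : ℝ) / 60, ((entry (element B i)).2.2.2.2 : ℝ) / 60) := by
  have h := (elements_spec B _ (element_mem B i)).2.2.2.2
  have h' : (((entry (element B i)).2.2.1 + (entry (element B i)).2.2.2.1 +
    (entry (element B i)).2.2.2.2 : ℤ) : ℝ) = 60 := by rw [h]; norm_num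
  push_cast at h'
  rw [domainPoint_eq_point, coords_point hv]
  simp only
  linarith

theorem home_spec (B : BasisLabel) (i : Fin 39) : home (entry (element B i)).2.2 < 12 ∧
    inside (home (entry (element B i)).2.2) (entry (element B i)).2.2 = true := by
  have h := check_eq_true B
  simp only [check, checkMatrix, Bool.and_eq_true, List.all_eq_true, force_eq] at h
  simpa using h.2.1.1 _ (entry_mem B i)

/-- The face whose cone contains the domain point. -/
def homeFace (B : BasisLabel) (i : Fin 39) : Fin 12 :=
  ⟨home (entry (element B i)).2.2, (home_spec B i).1⟩

theorem val_homeFace (B : BasisLabel) (i : Fin 39) :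
    (homeFace B i).val = home (entry (element B i)).2.2 := by rw [homeFace]

theorem inside_homeFace (B : BasisLabel) (i : Fin 39) :
    inside (homeFace B i) (entry (element B i)).2.2 = true := by
  rw [val_homeFace]
  exact (home_spec B i).2

theorem localCoords_div {k : ℕ} {z : ℤ × ℤ × ℤ} (h : inside k z = true) :
    localCoords k ((z.1 : ℝ) / 60, (z.2.1 : ℝ) / 60, (z.2.2 : ℝ) / 60) =
      (((idot (dualFrame k).1 z).natAbs : ℝ) / 60, ((idot (dualFrame k).2.1 z).natAbs : ℝ) / 60,
        ((idot (dualFrame k).2.2 z).natAbs : ℝ) / 60) := by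
  simp only [inside, Bool.and_eq_true, nonneg_iff] at h
  have e : ∀ l : ℤ × ℤ × ℤ, 0 ≤ idot l z →
      dot l ((z.1 : ℝ) / 60, (z.2.1 : ℝ) / 60, (z.2.2 : ℝ) / 60) =
        ((idot l z).natAbs : ℝ) / 60 := by
    intro l hl
    have : ((idot l z).natAbs : ℝ) = (idot l z : ℝ) := by
      rw [← Int.cast_natCast, Int.natAbs_of_nonneg hl]
    rw [this, idot_eq_dot]
    simp only [dot]
    push_cast
    ring
  rw [localCoords, e _ h.1, e _ h.2.1, e _ h.2.2]

theorem monomials_div (k : ℕ) (z : ℤ × ℤ × ℤ) :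
    monomials (((idot (dualFrame k).1 z).natAbs : ℝ) / 60,
      ((idot (dualFrame k).2.1 z).natAbs : ℝ) / 60,
        ((idot (dualFrame k).2.2 z).natAbs : ℝ) / 60) =
      (naturalMonomials k z).map fun m : ℕ => (m : ℝ) / 60 ^ 5 := by
  rw [monomials, naturalMonomials, List.map_map]
  refine List.map_congr_left fun e he => ?_
  have h := exponents_le e he
  have e5 : (60 : ℝ) ^ 5 = 60 ^ (5 - e.1 - e.2) * (60 ^ e.1 * 60 ^ e.2) := by
    rw [← pow_add, ← pow_add]
    congr 1
    omega
  simp only [Function.comp, Nat.mul_eq, Nat.pow_eq, Nat.cast_mul, Nat.cast_pow, div_pow]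
  rw [e5]
  field_simp

theorem ndotR_div (c m : List ℕ) (d : ℝ) :
    ndotR c (m.map fun x : ℕ => (x : ℝ) / d) = (ndot c m : ℝ) / d := by
  induction c generalizing m with
  | nil => simp [ndot, ndotR]
  | cons x xs ih =>
    cases m with
    | nil => simp [ndot, ndotR]
    | cons y ys =>
      rw [ndot_cons, Nat.cast_add, add_div, ← ih]
      simp [ndotR, mul_div_assoc]

/-- The numerators of the entries of the collocation matrix. -/
def numerator (B : BasisLabel) (i j : Fin 39) : ℕ := ((rows B).getD i []).getD j 0

theorem getElem_rows (B : BasisLabel) (i : Fin 39) (h : i.val < (rows B).length) :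
    (rows B)[i.val] = row (entries B) (homeFace B i)
      (naturalMonomials (homeFace B i) (entry (element B i)).2.2) := by
  simp only [rows, List.getElem_map, force_eq, val_homeFace]
  rw [getElem_entries]

theorem length_rows (B : BasisLabel) : (rows B).length = 39 := by
  rw [rows, List.length_map, length_entries]

theorem numerator_eq (B : BasisLabel) (i j : Fin 39) :
    numerator B i j = (entry (element B j)).1 *
      ndot (coefficients (homeFace B i) (entry (element B j)).2.1)
        (naturalMonomials (homeFace B i) (entry (element B i)).2.2) := by
  have hi : i.val < (rows B).length := by rw [length_rows]; exact i.2
  rw [numerator, List.getD_eq_getElem _ _ hi, getElem_rows,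
    List.getD_eq_getElem _ _ (by rw [row, List.length_map, length_entries]; exact j.2)]
  simp only [row, List.getElem_map, forceList_eq, Nat.mul_eq]
  rw [getElem_entries]

theorem localCoords_domainPoint (B : BasisLabel) {v : Fin 3 → Plane}
    (hv : orient (v 0) (v 1) (v 2) ≠ 0) (i : Fin 39) :
    localCoords (homeFace B i) (coords v (domainPoint B v i)) =
      (((idot (dualFrame (homeFace B i)).1 (entry (element B i)).2.2).natAbs : ℝ) / 60,
        ((idot (dualFrame (homeFace B i)).2.1 (entry (element B i)).2.2).natAbs : ℝ) / 60,
        ((idot (dualFrame (homeFace B i)).2.2 (entry (element B i)).2.2).natAbs : ℝ) / 60) := by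
  rw [coords_domainPoint B hv, localCoords_div (inside_homeFace B i)]

theorem coords_domainPoint_mem_cone (B : BasisLabel) {v : Fin 3 → Plane}
    (hv : orient (v 0) (v 1) (v 2) ≠ 0) (i : Fin 39) :
    coords v (domainPoint B v i) ∈ cone (homeFace B i) := by
  apply mem_cone_of_localCoords <;> rw [localCoords_domainPoint B hv] <;> positivity

theorem basisSpline_domainPoint (B : BasisLabel) {v : Fin 3 → Plane}
    (hv : orient (v 0) (v 1) (v 2) ≠ 0) (i j : Fin 39) :
    basisSpline B v j (domainPoint B v i) = numerator B i j / denominator := by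
  rw [basisSpline_eq_val B hv j (coords_domainPoint_mem_cone B hv i),
    ← combine_localCoords (homeFace B i) (coords v (domainPoint B v i)),
    val_eq_ndotR (checkCoefficients_entry B (entry_mem B j) _), localCoords_domainPoint B hv,
    monomials_div, ndotR_div, numerator_eq, denominator]
  push_cast
  ring

/-! ### The inverse of the collocation matrix -/

theorem decode_eq (n : ℕ) (X : List ℤ) (h : X.length = n) :
    decode X = ∑ j : Fin n, X.getD j 0 * radix ^ j.val := by
  induction X generalizing n with
  | nil => subst h; simp [decode]
  | cons x X ih =>
    obtain rfl : n = X.length + 1 := h.symm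
    rw [Fin.sum_univ_succ, decode, ih _ rfl]
    simp only [Int.add_def, Int.mul_def, Finset.mul_sum]
    simp [pow_succ]
    exact Finset.sum_congr rfl fun j _ => by ring

theorem combination_eq (n : ℕ) (c : List ℕ) (X : List ℤ) (hc : c.length = n) (hX : X.length = n) :
    combination c X = ∑ j : Fin n, (c.getD j 0 : ℤ) * X.getD j 0 := by
  induction c generalizing n X with
  | nil => subst hc; simp [combination]
  | cons x c ih =>
    obtain rfl : n = c.length + 1 := hc.symm
    obtain ⟨r, X, rfl⟩ := List.exists_cons_of_length_eq_add_one hX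
    rw [Fin.sum_univ_succ]
    have := ih _ X rfl (by simpa using hX)
    cases x <;> simp [combination, this]

/-- The matrix with the given rows. -/
def ofRows (X : List (List ℤ)) : Matrix (Fin 39) (Fin 39) ℤ :=
  Matrix.of fun i j => (X.getD i []).getD j 0

theorem getD_mem {α : Type*} {l : List α} {i : ℕ} (h : i < l.length) (d : α) : l.getD i d ∈ l := by
  rw [List.getD_eq_getElem _ _ h]
  exact List.getElem_mem h

/-- Rows are compared through their values as numbers in base `radix`; the digits are so small that
the values determine them. -/
theorem mul_of_checkInverse {N : List (List ℕ)} {d : ℤ} {X : List (List ℤ)} (hN : N.length = 39)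
    (hN' : ∀ r ∈ N, r.length = 39) (h : checkInverse N d X = true) (i j : Fin 39) :
    ∑ k : Fin 39, ((N.getD i []).getD k 0 : ℤ) * ofRows X k j = if i = j then d else 0 := by
  simp only [checkInverse, Bool.and_eq_true, List.all_eq_true, Nat.beq_eq, Bool.not_eq_true',
    decide_eq_false_iff_not, decide_eq_true_eq, Nat.blt_eq] at h
  obtain ⟨⟨⟨⟨⟨⟨hX, hX'⟩, -⟩, hd⟩, hXb⟩, hNb⟩, hall⟩ := h
  -- the digits of both sides differ by less than the base
  have hb : 39 * (2 ^ 40 * 2 ^ 1400) + 2 ^ 1500 < 2 ^ 1536 := by decide +kernel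
  have hr : radix = ((2 ^ 1536 : ℕ) : ℤ) := rfl
  generalize 2 ^ 1400 = a at hXb hb
  generalize 2 ^ 1500 = b at hd hb
  generalize 2 ^ 1536 = c at hr hb
  have hi : i.val < N.length := by rw [hN]; exact i.2
  have hrow := hall (N.getD i [], i.val) (by
    rw [List.mem_iff_getElem]
    exact ⟨i, by simp [hN], by simp [List.getElem_zip, List.getElem?_eq_getElem hi]⟩)
  have hXk : ∀ k : Fin 39, X.getD k [] ∈ X := fun k => getD_mem (by rw [hX]; exact k.2) _
  have hNi : N.getD i [] ∈ N := getD_mem hi _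
  have hdec : ∀ k : Fin 39, (X.map decode).getD k 0 =
      ∑ j : Fin 39, ofRows X k j * radix ^ j.val := by
    intro k
    have hk : k.val < X.length := by rw [hX]; exact k.2
    rw [List.getD_eq_getElem _ _ (by simpa using hk), List.getElem_map,
      decode_eq 39 _ (hX' _ (List.getElem_mem hk))]
    simp only [ofRows, Matrix.of_apply, List.getD_eq_getElem _ _ hk]
  rw [combination_eq 39 _ _ (hN' _ hNi) (by simpa using hX)] at hrow
  simp only [hdec, Finset.mul_sum] at hrow
  rw [Finset.sum_comm] at hrow
  have hpow : Int.mul d (Int.pow radix i.val) = d * radix ^ i.val := rfl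
  have hdel : d * radix ^ i.val = ∑ j : Fin 39, (if i = j then d else 0) * radix ^ j.val := by
    simp
  rw [hpow, hdel, ← sub_eq_zero, ← Finset.sum_sub_distrib] at hrow
  have hz := eq_zero_of_sum_pow (b := radix) Finset.univ (fun j : Fin 39 => j.val)
    (fun j => (∑ k : Fin 39, ((N.getD i []).getD k 0 : ℤ) * ofRows X k j) - if i = j then d else 0)
    (fun _ _ _ _ h => Fin.ext h) ?_ ?_ j (Finset.mem_univ j)
  · exact sub_eq_zero.1 hz
  · intro j _
    have h1 : |∑ k : Fin 39, ((N.getD i []).getD k 0 : ℤ) * ofRows X k j| ≤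
        ∑ _k : Fin 39, (2 ^ 40 * a : ℤ) := by
      refine (Finset.abs_sum_le_sum_abs _ _).trans (Finset.sum_le_sum fun k _ => ?_)
      rw [abs_mul]
      refine mul_le_mul ?_ ?_ (abs_nonneg _) (by positivity)
      · rw [Nat.abs_cast]
        exact_mod_cast (hNb _ hNi _ (getD_mem (by rw [hN' _ hNi]; exact k.2) _)).le
      · rw [Int.abs_eq_natAbs]
        exact_mod_cast (hXb _ (hXk k) _ (getD_mem (by rw [hX' _ (hXk k)]; exact j.2) _)).le
    have h2 : |if i = j then d else 0| ≤ (b : ℤ) := by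
      split_ifs
      · rw [Int.abs_eq_natAbs]
        exact_mod_cast hd.le
      · simp
    refine ((abs_sub _ _).trans (add_le_add h1 h2)).trans_lt ?_
    rw [Finset.sum_const, Finset.card_univ, Fintype.card_fin, nsmul_eq_mul, hr]
    exact_mod_cast hb
  · refine Eq.trans (Finset.sum_congr rfl fun j _ => ?_) hrow
    rw [sub_mul, Finset.sum_mul]
    simp only [mul_assoc]

/-- The collocation matrix, which does not depend on the triangle. -/
def rationalMatrix (B : BasisLabel) : Matrix (Fin 39) (Fin 39) ℚ :=
  Matrix.of fun i j => (numerator B i j : ℚ) / denominator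

/-- The pivot of the last step of the elimination in the matrix of numerators. -/
def pivot (B : BasisLabel) : ℤ := (adjugate (rows B)).1

/-- The multiple by `pivot B` of the inverse of the matrix of numerators. -/
def cofactor (B : BasisLabel) : Matrix (Fin 39) (Fin 39) ℤ := ofRows (adjugate (rows B)).2

theorem collocation_eq (B : BasisLabel) {v : Fin 3 → Plane}
    (hv : orient (v 0) (v 1) (v 2) ≠ 0) :
    collocation B v = (rationalMatrix B).map fun q : ℚ => (q : ℝ) := by
  ext i j
  simp [collocation, rationalMatrix, basisSpline_domainPoint B hv]

theorem checkMatrix_eq_true (B : BasisLabel) : checkMatrix B = true := by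
  have h := check_eq_true B
  rw [check, Bool.and_eq_true] at h
  exact h.2

theorem pivot_ne_zero (B : BasisLabel) : pivot B ≠ 0 := by
  have h := checkMatrix_eq_true B
  simp only [checkMatrix, checkInverse, Bool.and_eq_true, Bool.not_eq_true',
    decide_eq_false_iff_not] at h
  exact h.2.1.1.1.1.2

theorem length_of_mem_rows (B : BasisLabel) : ∀ r ∈ rows B, r.length = 39 := by
  intro r hr
  obtain ⟨e, -, rfl⟩ := List.mem_map.1 hr
  rw [force_eq, row, List.length_map, length_entries]

theorem sum_numerator_mul (B : BasisLabel) (i j : Fin 39) :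
    ∑ k, (numerator B i k : ℤ) * cofactor B k j = if i = j then pivot B else 0 := by
  have h := checkMatrix_eq_true B
  rw [checkMatrix, Bool.and_eq_true] at h
  exact mul_of_checkInverse (length_rows B) (length_of_mem_rows B) h.2 i j

theorem rationalMatrix_mul (B : BasisLabel) :
    rationalMatrix B *
      ((denominator / pivot B : ℚ) • (cofactor B).map fun z : ℤ => (z : ℚ)) = 1 := by
  have hp : (pivot B : ℚ) ≠ 0 := by exact_mod_cast pivot_ne_zero B
  have hd : (denominator : ℚ) ≠ 0 := by norm_num [denominator]
  ext i j
  have h : ∑ k, (numerator B i k : ℚ) * cofactor B k j = if i = j then (pivot B : ℚ) else 0 := by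
    exact_mod_cast congrArg (fun z : ℤ => (z : ℚ)) (sum_numerator_mul B i j)
  rw [Matrix.mul_smul, Matrix.smul_apply, Matrix.mul_apply, Matrix.one_apply]
  simp only [rationalMatrix, Matrix.of_apply, Matrix.map_apply, div_mul_eq_mul_div]
  rw [← Finset.sum_div, h, smul_eq_mul]
  split_ifs
  · field_simp
  · simp

theorem inv_rationalMatrix (B : BasisLabel) : (rationalMatrix B)⁻¹ =
    (denominator / pivot B : ℚ) • (cofactor B).map fun z : ℤ => (z : ℚ) :=
  Matrix.inv_eq_right_inv (rationalMatrix_mul B)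

theorem isUnit_rationalMatrix (B : BasisLabel) : IsUnit (rationalMatrix B) :=
  (Matrix.isUnit_iff_isUnit_det _).2 (Matrix.isUnit_det_of_right_inverse (rationalMatrix_mul B))

theorem norm_inv_pos (B : BasisLabel) : 0 < ‖(rationalMatrix B)⁻¹‖ := by
  rw [norm_pos_iff]
  intro h
  have h1 := rationalMatrix_mul B
  rw [← inv_rationalMatrix, h, mul_zero] at h1
  exact zero_ne_one h1

theorem norm_eq_of_row_sums {m α : Type*} [Fintype m] [NormedAddCommGroup α] (A : Matrix m m α)
    {C : ℝ} (h : ∀ i, ∑ j, ‖A i j‖ ≤ C) (h' : ∃ i, ∑ j, ‖A i j‖ = C) : ‖A‖ = C := by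
  obtain ⟨i, hi⟩ := h'
  have hC : 0 ≤ C := hi ▸ Finset.sum_nonneg fun j _ => norm_nonneg _
  lift C to NNReal using hC
  have e : ∀ i, ∑ j, ‖A i j‖ = ((∑ j, ‖A i j‖₊ : NNReal) : ℝ) := fun i => by simp
  rw [Matrix.linfty_opNorm_def, NNReal.coe_inj]
  refine le_antisymm (Finset.sup_le fun i _ => ?_) ?_
  · have := h i
    rw [e] at this
    exact_mod_cast this
  · rw [e, NNReal.coe_inj] at hi
    rw [← hi]
    exact Finset.le_sup (f := fun i => ∑ j, ‖A i j‖₊) (Finset.mem_univ i)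

theorem sum_numerator (B : BasisLabel) (i : Fin 39) : ∑ j, numerator B i j = denominator := by
  have h := checkMatrix_eq_true B
  simp only [checkMatrix, Bool.and_eq_true, List.all_eq_true, Nat.beq_eq] at h
  have hi : i.val < (rows B).length := by rw [length_rows]; exact i.2
  have hm := getD_mem hi []
  rw [← h.1.2 _ hm, ← Fin.sum_univ_getElem]
  refine Fintype.sum_equiv (finCongr (length_of_mem_rows B _ hm).symm) _ _ fun j => ?_
  rw [numerator, List.getD_eq_getElem _ 0]
  rfl

theorem norm_rationalMatrix (B : BasisLabel) : ‖rationalMatrix B‖ = 1 := by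
  have h : ∀ i, ∑ j, ‖rationalMatrix B i j‖ = 1 := by
    intro i
    have e : ∀ j, ‖rationalMatrix B i j‖ = (numerator B i j : ℝ) / denominator := by
      intro j
      rw [rationalMatrix, Matrix.of_apply, ← Rat.norm_cast_real]
      push_cast
      exact Real.norm_of_nonneg (by positivity)
    have hs : (∑ j, (numerator B i j : ℝ)) = denominator := by exact_mod_cast sum_numerator B i
    simp only [e]
    rw [← Finset.sum_div, hs]
    exact div_self (by norm_num [denominator])
  exact norm_eq_of_row_sums _ (fun i => (h i).le) ⟨0, h 0⟩

/-! ### The norm of the inverse for the basis `c` -/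

theorem le_foldr_max {l : List ℕ} {x : ℕ} (h : x ∈ l) : x ≤ l.foldr max 0 := by
  induction l with
  | nil => simp at h
  | cons y l ih =>
    rcases List.mem_cons.1 h with rfl | h
    · exact le_max_left _ _
    · exact (ih h).trans (le_max_right _ _)

theorem foldr_max_mem {l : List ℕ} (h : l ≠ []) : l.foldr max 0 ∈ l := by
  induction l with
  | nil => exact absurd rfl h
  | cons y l ih =>
    rw [List.foldr_cons]
    rcases eq_or_ne l [] with rfl | hl
    · simp
    · rcases max_choice y (l.foldr max 0) with e | e <;> rw [e]
      · exact List.mem_cons_self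
      · exact List.mem_cons_of_mem _ (ih hl)

theorem getD_rowSums {X : List (List ℤ)} (hX : X.length = 39) (hX' : ∀ r ∈ X, r.length = 39)
    (i : Fin 39) : (rowSums X).getD i 0 = ∑ j, (ofRows X i j).natAbs := by
  have hi : i.val < X.length := by rw [hX]; exact i.2
  rw [rowSums, List.getD_eq_getElem _ _ (by simpa using hi), List.getElem_map,
    ← Fin.sum_univ_fun_getElem]
  refine Fintype.sum_equiv (finCongr (hX' _ (List.getElem_mem hi))) _ _ fun j => ?_
  simp [ofRows, List.getElem?_eq_getElem hi]

theorem norm_ofRows {X : List (List ℤ)} (hX : X.length = 39) (hX' : ∀ r ∈ X, r.length = 39)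
    (q : ℚ) : ‖q • (ofRows X).map fun z : ℤ => (z : ℚ)‖ = |(q : ℝ)| * maxRowSum X := by
  have e : ∀ i, ∑ j, ‖(q • (ofRows X).map fun z : ℤ => (z : ℚ)) i j‖ =
      |(q : ℝ)| * (rowSums X).getD i 0 := by
    intro i
    rw [getD_rowSums hX hX']
    push_cast
    rw [Finset.mul_sum]
    refine Finset.sum_congr rfl fun j _ => ?_
    rw [Matrix.smul_apply, Matrix.map_apply, smul_eq_mul, ← Rat.norm_cast_real]
    push_cast
    rw [norm_mul, Real.norm_eq_abs, Real.norm_eq_abs, ← Int.cast_abs, Int.abs_eq_natAbs,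
      Int.cast_natCast]
  have hlen : (rowSums X).length = 39 := by rw [rowSums, List.length_map, hX]
  refine norm_eq_of_row_sums _ (fun i => ?_) ?_
  · rw [e]
    refine mul_le_mul_of_nonneg_left ?_ (abs_nonneg _)
    exact_mod_cast le_foldr_max (getD_mem (by rw [hlen]; exact i.2) _)
  · have hm : maxRowSum X ∈ rowSums X := foldr_max_mem (by
      rintro h
      rw [h] at hlen
      simp at hlen)
    obtain ⟨i, hi, h⟩ := List.mem_iff_getElem.1 hm
    refine ⟨⟨i, hlen ▸ hi⟩, ?_⟩
    rw [e, ← h, List.getD_eq_getElem _ _ hi]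

theorem norm_inv_rationalMatrix_c : ‖(rationalMatrix .c)⁻¹‖ =
    60866923187443943219194678615331 / 836197581250152380489105335680 := by
  have h := checkMatrix_eq_true .c
  simp only [checkMatrix, checkInverse, Bool.and_eq_true, List.all_eq_true, Nat.beq_eq] at h
  have hX := h.2.1.1.1.1.1.1
  have hX' := h.2.1.1.1.1.1.2
  have hn := checkNorm_eq_true
  rw [checkNorm, decide_eq_true_eq] at hn
  have hp : (0 : ℝ) < (pivot .c).natAbs := by
    exact_mod_cast Int.natAbs_pos.2 (pivot_ne_zero .c)
  have hcast : ∀ p q r : ℕ, 60866923187443943219194678615331 * p =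
      836197581250152380489105335680 * (q * r) → (60866923187443943219194678615331 : ℝ) * p =
        836197581250152380489105335680 * (q * r) := fun p q r h => by exact_mod_cast h
  have hn' := hcast _ _ _ hn
  rw [inv_rationalMatrix, cofactor, norm_ofRows hX hX']
  push_cast
  rw [abs_div, Nat.abs_cast, ← Int.cast_abs, Int.abs_eq_natAbs, Int.cast_natCast]
  rw [eq_div_iff (by norm_num), div_mul_eq_mul_div, div_mul_eq_mul_div, div_eq_iff hp.ne']
  rw [pivot, hn']
  ring

/-! ### Uniform norms -/

theorem interior_triangle_nonempty {v : Fin 3 → Plane} (hv : AffineIndependent ℝ v) :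
    (interior (triangle v)).Nonempty := by
  rw [triangle, interior_convexHull_nonempty_iff_affineSpan_eq_top]
  exact hv.affineSpan_eq_top_iff_card_eq_finrank_add_one.2 (by simp)

theorem isClosed_triangle (v : Fin 3 → Plane) : IsClosed (triangle v) :=
  (Set.finite_range v).isClosed_convexHull ℝ

theorem eLpNorm_le_of_forall_abs_le {X : Type*} [MeasurableSpace X] {μ : Measure X} {s : Set X}
    (hs : MeasurableSet s) {f : X → ℝ} {C : ℝ} (h : ∀ x ∈ s, |f x| ≤ C) :
    eLpNorm f ⊤ (μ.restrict s) ≤ ENNReal.ofReal C := by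
  rw [eLpNorm_exponent_top]
  exact eLpNormEssSup_le_of_ae_bound ((ae_restrict_iff' hs).2 (ae_of_all _ h))

/-- On a convex body, the values of a continuous function are bounded by its essential supremum. -/
theorem abs_le_eLpNorm {s : Set Plane} (hs : Convex ℝ s) (hs' : (interior s).Nonempty)
    {f : Plane → ℝ} (hf : ContinuousOn f s) {x : Plane} (hx : x ∈ s) :
    ENNReal.ofReal |f x| ≤ eLpNorm f ⊤ (volume.restrict s) := by
  by_contra! hlt
  set C := eLpNorm f ⊤ (volume.restrict s) with hC
  -- near `x`, the function exceeds its essential supremum, and interior points accumulate there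
  have hev : ∀ᶠ y in nhdsWithin x s, C < ENNReal.ofReal |f y| :=
    ((ENNReal.continuous_ofReal.tendsto _).comp (hf x hx).abs).eventually_const_lt hlt
  obtain ⟨U, hU, hxU, hUs⟩ := mem_nhdsWithin.1 hev
  have hcl : x ∈ closure (interior s) := by
    rw [hs.closure_interior_eq_closure_of_nonempty_interior hs']
    exact subset_closure hx
  have hne : (U ∩ interior s).Nonempty := mem_closure_iff.1 hcl U hU hxU
  have hpos := (hU.inter isOpen_interior).measure_pos volume hne
  have hae : ∀ᵐ y ∂volume.restrict s, ENNReal.ofReal |f y| ≤ C := by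
    have := ae_le_eLpNormEssSup (f := f) (μ := volume.restrict s)
    filter_upwards [this] with y hy
    rw [hC, eLpNorm_exponent_top, ← Real.norm_eq_abs, ofReal_norm]
    exact hy
  have hae' : ∀ᵐ y ∂volume.restrict (U ∩ interior s), ENNReal.ofReal |f y| ≤ C :=
    ae_mono (Measure.restrict_mono (Set.inter_subset_right.trans interior_subset) le_rfl) hae
  rw [ae_restrict_iff' (hU.inter isOpen_interior).measurableSet] at hae'
  refine hpos.ne' (measure_mono_null ?_ hae')
  intro y hy h
  exact absurd (h hy) (not_le.2 (hUs ⟨hy.1, interior_subset hy.2⟩))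

/-! ### Interpolation and conditioning -/

theorem domainPoint_mem_triangle (B : BasisLabel) {v : Fin 3 → Plane}
    (hv : orient (v 0) (v 1) (v 2) ≠ 0) (i : Fin 39) : domainPoint B v i ∈ triangle v :=
  mem_triangle_of_cone hv (coords_domainPoint_mem_cone B hv i)

theorem spline_domainPoint (B : BasisLabel) (v : Fin 3 → Plane) (c : Fin 39 → ℝ) :
    (fun i => spline B v c (domainPoint B v i)) = (collocation B v).mulVec c := by
  funext i
  simp [spline, collocation, Matrix.mulVec, dotProduct, mul_comm]

/-- The splines of a basis are nonnegative and sum to `1`, so that values of a spline are convex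
combinations of its coefficients. -/
theorem abs_spline_le (B : BasisLabel) {v : Fin 3 → Plane}
    (hv : orient (v 0) (v 1) (v 2) ≠ 0) (c : Fin 39 → ℝ) {x : Plane} (hx : x ∈ triangle v) :
    |spline B v c x| ≤ ‖c‖ := by
  calc |spline B v c x| ≤ ∑ i, |c i * basisSpline B v i x| := Finset.abs_sum_le_sum_abs _ _
    _ ≤ ∑ i, ‖c‖ * basisSpline B v i x := by
        refine Finset.sum_le_sum fun i _ => ?_
        rw [abs_mul, abs_of_nonneg (basisSpline_nonneg B hv i hx)]
        exact mul_le_mul_of_nonneg_right (norm_le_pi_norm c i) (basisSpline_nonneg B hv i hx)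
    _ = ‖c‖ := by rw [← Finset.mul_sum, sum_basisSpline B hv hx, mul_one]

theorem norm_map_ratCast (A : Matrix (Fin 39) (Fin 39) ℚ) :
    ‖A.map fun q : ℚ => (q : ℝ)‖ = ‖A‖ := by
  have h : ∀ q : ℚ, ‖(q : ℝ)‖₊ = ‖q‖₊ := fun q => NNReal.eq (Rat.norm_cast_real q)
  simp only [Matrix.linfty_opNorm_def, Matrix.map_apply, h]

theorem inv_mul_collocation (B : BasisLabel) {v : Fin 3 → Plane}
    (hv : orient (v 0) (v 1) (v 2) ≠ 0) :
    ((rationalMatrix B)⁻¹.map fun q : ℚ => (q : ℝ)) * collocation B v = 1 := by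
  rw [collocation_eq B hv]
  have h := Matrix.nonsing_inv_mul (rationalMatrix B)
    ((Matrix.isUnit_iff_isUnit_det _).1 (isUnit_rationalMatrix B))
  have := congrArg (fun A => A.map (Rat.castHom ℝ)) h
  rw [Matrix.map_mul, Matrix.map_one _ (map_zero _) (map_one _)] at this
  exact this

/-- The coefficients of a spline are recovered from its values at the domain points by the inverse
of the collocation matrix. -/
theorem norm_coefficients_le (B : BasisLabel) {v : Fin 3 → Plane}
    (hv : orient (v 0) (v 1) (v 2) ≠ 0) (c : Fin 39 → ℝ) :
    ‖c‖ ≤ ‖(rationalMatrix B)⁻¹‖ * ‖fun i => spline B v c (domainPoint B v i)‖ := by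
  have h : ((rationalMatrix B)⁻¹.map fun q : ℚ => (q : ℝ)).mulVec
      (fun i => spline B v c (domainPoint B v i)) = c := by
    rw [spline_domainPoint, Matrix.mulVec_mulVec, inv_mul_collocation B hv, Matrix.one_mulVec]
  calc ‖c‖ = _ := by rw [h]
    _ ≤ _ := Matrix.linfty_opNorm_mulVec _ _
    _ = _ := by rw [norm_map_ratCast]

theorem norm_domainPoint_le (B : BasisLabel) {v : Fin 3 → Plane} (hv : AffineIndependent ℝ v)
    (c : Fin 39 → ℝ) : ENNReal.ofReal ‖fun i => spline B v c (domainPoint B v i)‖ ≤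
      eLpNorm (spline B v c) ⊤ (volume.restrict (triangle v)) := by
  have ho := orient_ne_zero hv
  obtain ⟨i, hi⟩ : ∃ i, ‖fun i => spline B v c (domainPoint B v i)‖ =
      ‖spline B v c (domainPoint B v i)‖ := by
    obtain ⟨i, hi⟩ := Finite.exists_max fun i => ‖spline B v c (domainPoint B v i)‖
    exact ⟨i, le_antisymm ((pi_norm_le_iff_of_nonneg (norm_nonneg _)).2 hi)
      (norm_le_pi_norm (fun i => spline B v c (domainPoint B v i)) i)⟩
  rw [hi, Real.norm_eq_abs]
  exact abs_le_eLpNorm (convex_convexHull ℝ _) (interior_triangle_nonempty hv)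
    (spline_mem_splineSpace B ho c).1.continuousOn (domainPoint_mem_triangle B ho i)

theorem existsUnique_spline (B : BasisLabel) {v : Fin 3 → Plane}
    (hv : orient (v 0) (v 1) (v 2) ≠ 0) (y : Fin 39 → ℝ) :
    ∃! c : Fin 39 → ℝ, ∀ i, spline B v c (domainPoint B v i) = y i := by
  have h := inv_mul_collocation B hv
  have h' := mul_eq_one_comm.1 h
  have e : ∀ c, (∀ i, spline B v c (domainPoint B v i) = y i) ↔ (collocation B v).mulVec c = y := by
    intro c
    rw [← spline_domainPoint, funext_iff]
  simp only [e]
  refine ⟨((rationalMatrix B)⁻¹.map fun q : ℚ => (q : ℝ)).mulVec y, ?_, fun c hc => ?_⟩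
  · simp only [Matrix.mulVec_mulVec, h', Matrix.one_mulVec]
  · rw [← hc, Matrix.mulVec_mulVec, h, Matrix.one_mulVec]

end PS12

theorem mainTheorem2 (B : PS12.BasisLabel) :
    ∃ M : Matrix (Fin 39) (Fin 39) ℚ,
      IsUnit M ∧ 0 < ‖M⁻¹‖ ∧ ‖M‖ = 1 ∧
      (B = PS12.BasisLabel.c →
        ‖M⁻¹‖ = 60866923187443943219194678615331 / 836197581250152380489105335680 ∧
        |‖M⁻¹‖ - 72.7901| < 0.00005) ∧
      ∀ v : Fin 3 → EuclideanSpace ℝ (Fin 2), AffineIndependent ℝ v →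
        PS12.collocation B v = M.map (fun q : ℚ => (q : ℝ)) ∧
        (∀ c : Fin 39 → ℝ,
          PS12.spline B v c ∈ PS12.splineSpace 3 5 v ∧
          ENNReal.ofReal (‖M⁻¹‖⁻¹ * ‖c‖) ≤
            eLpNorm (PS12.spline B v c) ⊤ (volume.restrict (PS12.triangle v)) ∧
          eLpNorm (PS12.spline B v c) ⊤ (volume.restrict (PS12.triangle v)) ≤
            ENNReal.ofReal ‖c‖) ∧
        (∀ y : Fin 39 → ℝ, ∃! c : Fin 39 → ℝ,
          ∀ i, PS12.spline B v c (PS12.domainPoint B v i) = y i) ∧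
        (∀ c : Fin 39 → ℝ,
          eLpNorm (PS12.spline B v c) ⊤ (volume.restrict (PS12.triangle v)) ≤
            ENNReal.ofReal (‖M⁻¹‖ *
              ‖fun i => PS12.spline B v c (PS12.domainPoint B v i)‖)) := by
  refine ⟨PS12.rationalMatrix B, PS12.isUnit_rationalMatrix B, PS12.norm_inv_pos B,
    PS12.norm_rationalMatrix B, ?_, fun v hv => ?_⟩
  · rintro rfl
    rw [PS12.norm_inv_rationalMatrix_c]
    exact ⟨rfl, by rw [abs_lt]; constructor <;> norm_num⟩
  have ho := PS12.orient_ne_zero hv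
  have hm := (PS12.isClosed_triangle v).measurableSet
  have hc : ∀ c, ENNReal.ofReal ‖c‖ ≥
      eLpNorm (PS12.spline B v c) ⊤ (volume.restrict (PS12.triangle v)) := fun c =>
    PS12.eLpNorm_le_of_forall_abs_le hm fun x hx => PS12.abs_spline_le B ho c hx
  refine ⟨PS12.collocation_eq B ho, fun c => ⟨PS12.spline_mem_splineSpace B ho c, ?_, hc c⟩,
    PS12.existsUnique_spline B ho, fun c => (hc c).trans ?_⟩
  · refine (ENNReal.ofReal_le_ofReal ?_).trans (PS12.norm_domainPoint_le B hv c)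
    rw [inv_mul_le_iff₀ (PS12.norm_inv_pos B)]
    exact PS12.norm_coefficients_le B ho c
  · exact ENNReal.ofReal_le_ofReal (PS12.norm_coefficients_le B ho c)
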